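/- Let $(M,g)$ be a four-dimensional smooth manifold with a smooth Lorentzian metric of signature $(-,+,+,+)$, and let $u$ be a vector field on $M$. Suppose that $(M,g)$ is a twisted space-time with velocity field $u$, in either of the following two senses: (a) around every point there are coordinates $(t,x^1,x^2,x^3)$ in which $$ds^2=-dt^2+f^2(x,t)\,g^*_{\mu\nu}(x)\,dx^\mu dx^\nu,\qquad u=\partial_t,$$ where $f>0$ is smooth and $g^*_{\mu\nu}$ is a smooth Riemannian metric depending only on $x=(x^1,x^2,x^3)$; or (b) $u$ is smooth, $u_ku^k=-1$, and $\nabla_iu_j=\varphi\,(g_{ij}+u_iu_j)$ for some scalar field $\varphi$ on $M$. Let $C_{jklm}$ be the Weyl tensor of $g$ and let $E_{kl}=u^ju^mC_{jklm}$ be its electric part with respect to $u$. Then, at every point $p\in M$, $C_{abcd}=0$ at $p$ if and only if $E_{ab}=0$ at $p$. In particular, $C_{abcd}$ vanishes identically on $M$ if and only if $E_{ab}$ vanishes identically on $M$. -/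

import Mathlib

open scoped Manifold ContDiff

noncomputable section

namespace TwistedSpacetime

/-- Coordinate space of a four-dimensional space-time. The index `0` is used for time. -/
abbrev R4 : Type := EuclideanSpace ℝ (Fin 4)

section Fields

variable {M : Type*} [TopologicalSpace M] [ChartedSpace R4 M]

/-- The coordinate vector `∂_i` of the chart `e`, at the point with coordinates `y`. -/
def coordVec (e : OpenPartialHomeomorph M R4) (y : R4) (i : Fin 4) :
    TangentSpace (𝓡 4) (e.symm y) :=
  mfderiv (𝓡 4) (𝓡 4) e.symm y (EuclideanSpace.single i (1 : ℝ) : R4)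

variable (M) in
/-- A smooth Lorentzian metric, of signature `(-,+,+,+)`, on a four-dimensional manifold. -/
structure LorentzMetric where
  /-- The scalar product on each tangent space. -/
  val : ∀ p : M, LinearMap.BilinForm ℝ (TangentSpace (𝓡 4) p)
  symm : ∀ (p : M) (v w : TangentSpace (𝓡 4) p), val p v w = val p w v
  lorentzian : ∀ p : M, ∃ b : Module.Basis (Fin 4) ℝ (TangentSpace (𝓡 4) p),
    ∀ i j, val p (b i) (b j) = if i = j then (if i = 0 then -1 else 1) else 0
  smooth : ∀ e ∈ IsManifold.maximalAtlas (𝓡 4) ∞ M, ∀ i j,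
    ContDiffOn ℝ ∞ (fun y => val (e.symm y) (coordVec e y i) (coordVec e y j)) e.target

/-- The contravariant components `u^i` of a vector field in the chart `e`. -/
def upper (u : ∀ p : M, TangentSpace (𝓡 4) p) (e : OpenPartialHomeomorph M R4)
    (y : R4) (i : Fin 4) : ℝ :=
  let v : R4 := mfderiv (𝓡 4) (𝓡 4) e (e.symm y) (u (e.symm y))
  v i

/-- The partial derivative `∂_i F`. -/
def pd (i : Fin 4) (F : R4 → ℝ) (y : R4) : ℝ :=
  fderiv ℝ F y (EuclideanSpace.single i (1 : ℝ))

variable (g : LorentzMetric M) (u : ∀ p : M, TangentSpace (𝓡 4) p)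
  (e : OpenPartialHomeomorph M R4)

/-- The components `g_{ij}` of the metric in the chart `e`. -/
def metric (y : R4) (i j : Fin 4) : ℝ :=
  g.val (e.symm y) (coordVec e y i) (coordVec e y j)

/-- The components `g^{ij}` of the inverse metric. -/
def metricInv (y : R4) (i j : Fin 4) : ℝ :=
  (Matrix.of (metric g e y))⁻¹ i j

/-- The Christoffel symbols `Γ^k_{ij}` of the Levi-Civita connection. -/
def christoffel (y : R4) (k i j : Fin 4) : ℝ :=
  (1 / 2) * ∑ l, metricInv g e y k l *
    (pd i (fun z => metric g e z l j) y + pd j (fun z => metric g e z l i) y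
      - pd l (fun z => metric g e z i j) y)

/-- The component along `∂_m` of `R(∂_j, ∂_k) ∂_l`, where
`R(X, Y) = ∇_X ∇_Y - ∇_Y ∇_X - ∇_{[X, Y]}`. -/
def curvature (y : R4) (j k l m : Fin 4) : ℝ :=
  pd j (fun z => christoffel g e z m k l) y - pd k (fun z => christoffel g e z m j l) y
    + ∑ p, (christoffel g e y m j p * christoffel g e y p k l
      - christoffel g e y m k p * christoffel g e y p j l)

/-- The covariant Riemann tensor `R_{jklm} = g(R(∂_j, ∂_k) ∂_m, ∂_l)`. -/
def riemann (y : R4) (j k l m : Fin 4) : ℝ :=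
  ∑ p, metric g e y l p * curvature g e y j k m p

/-- The Ricci tensor `R_{kl}`, the trace of `X ↦ R(X, ∂_k) ∂_l`
(positive on round spheres). -/
def ricci (y : R4) (k l : Fin 4) : ℝ :=
  ∑ m, curvature g e y m k l m

/-- The scalar curvature. -/
def scalarCurvature (y : R4) : ℝ :=
  ∑ k, ∑ l, metricInv g e y k l * ricci g e y k l

/-- The Weyl tensor `C_{jklm}` in dimension `n = 4`, so that `1 / (n - 2) = 1 / 2` and
`1 / ((n - 1) * (n - 2)) = 1 / 6`. -/
def weyl (y : R4) (j k l m : Fin 4) : ℝ :=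
  riemann g e y j k l m
    + (1 / 2) * (metric g e y j m * ricci g e y k l - metric g e y k m * ricci g e y j l
      + metric g e y k l * ricci g e y j m - metric g e y j l * ricci g e y k m)
    - (1 / 6) * scalarCurvature g e y *
      (metric g e y j m * metric g e y k l - metric g e y k m * metric g e y j l)

/-- The electric part `E_{kl} = u^j u^m C_{jklm}` of the Weyl tensor. -/
def electric (y : R4) (k l : Fin 4) : ℝ :=
  ∑ j, ∑ m, upper u e y j * upper u e y m * weyl g e y j k l m

/-- The covariant components `u_j = g_{ij} u^i`. -/
def lower (y : R4) (j : Fin 4) : ℝ :=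
  ∑ i, metric g e y i j * upper u e y i

/-- The covariant derivative `∇_i u_j = ∂_i u_j - Γ^k_{ij} u_k`. -/
def nablaLower (y : R4) (i j : Fin 4) : ℝ :=
  pd i (fun z => lower g u e z j) y - ∑ k, christoffel g e y k i j * lower g u e y k

/-- `u` is a smooth time-like unit vector field and `∇_i u_j = φ (g_{ij} + u_i u_j)`
for some scalar field `φ`: it is shear-free, vorticity-free and acceleration-free. -/
def IsTorseForming : Prop :=
  (∀ e ∈ IsManifold.maximalAtlas (𝓡 4) ∞ M, ∀ i,
    ContDiffOn ℝ ∞ (fun y => upper u e y i) e.target) ∧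
  (∀ p, g.val p (u p) (u p) = -1) ∧
  ∃ φ : M → ℝ, ∀ e ∈ IsManifold.maximalAtlas (𝓡 4) ∞ M, ∀ y ∈ e.target, ∀ i j,
    nablaLower g u e y i j =
      φ (e.symm y) * (metric g e y i j + lower g u e y i * lower g u e y j)

/-- The space coordinates `(x^1, x^2, x^3)` of `y = (t, x^1, x^2, x^3)`. -/
def space (y : R4) : EuclideanSpace ℝ (Fin 3) :=
  WithLp.toLp 2 fun μ => y μ.succ

/-- In the chart `e`, with coordinates `(t, x)`, the metric is
`-dt² + f²(x, t) g*_{μν}(x) dx^μ dx^ν` with `f > 0` and `g*` Riemannian, and `u = ∂_t`. -/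
def IsTwistedChart : Prop :=
  ∃ (f : R4 → ℝ) (gs : EuclideanSpace ℝ (Fin 3) → Matrix (Fin 3) (Fin 3) ℝ),
    ContDiffOn ℝ ∞ f e.target ∧ (∀ y ∈ e.target, 0 < f y) ∧
    (∀ μ ν, ContDiffOn ℝ ∞ (fun x => gs x μ ν) (space '' e.target)) ∧
    (∀ x ∈ space '' e.target, (gs x).PosDef) ∧
    ∀ y ∈ e.target,
      metric g e y 0 0 = -1 ∧
      (∀ μ : Fin 3, metric g e y 0 μ.succ = 0) ∧
      (∀ μ ν : Fin 3, metric g e y μ.succ ν.succ = f y ^ 2 * gs (space y) μ ν) ∧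
      u (e.symm y) = coordVec e y 0

/-- The space-time is twisted, with velocity field `u`: around every point there are
coordinates in which the metric has the twisted form and `u = ∂_t`. -/
def IsTwisted : Prop :=
  ∀ p : M, ∃ e ∈ IsManifold.maximalAtlas (𝓡 4) ∞ M, p ∈ e.source ∧ IsTwistedChart g u e

/-- All components of the Weyl tensor vanish at `p`, in every chart around `p`. -/
def WeylVanishesAt (p : M) : Prop :=
  ∀ e ∈ IsManifold.maximalAtlas (𝓡 4) ∞ M, p ∈ e.source →
    ∀ j k l m, weyl g e (e p) j k l m = 0

/-- All components of the electric part of the Weyl tensor vanish at `p`, in every chart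
around `p`. -/
def ElectricVanishesAt (p : M) : Prop :=
  ∀ e ∈ IsManifold.maximalAtlas (𝓡 4) ∞ M, p ∈ e.source →
    ∀ k l, electric g u e (e p) k l = 0

end Fields

end TwistedSpacetime

end

noncomputable section

namespace TwistedSpacetime

open Filter Topology

/-! ### Calculus of partial derivatives on coordinate space. -/

section PartialDerivatives

variable {F G : R4 → ℝ} {y : R4}

/-! The electric part is a contraction of the Weyl tensor, so only the converse needs an argument.
The key is the torse-forming equation `∇_i u_j = φ h_{ij}` with `h = g + u ⊗ u`. The Ricci identity
turns it into `u^l R_{jklm} = w_j h_{km} - w_k h_{jm}`, where `w_j = φ² u_j - ∂_j φ`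
(`sum_upper_mul_riemann`).

In an orthonormal frame whose first vector is `u`, tracing this relation gives `Ric_{b0} = 2 w_b`
for spatial `b`. The Ricci terms of the Weyl tensor then cancel `R_{ab0d}` for spatial `a, b, d`:
the magnetic part vanishes (`frameWeyl_eq_zero`). If the electric part vanishes too, every component
with a time index is zero. What remains is a trace-free tensor with Riemann symmetries on a
three-dimensional Euclidean space, and there such a tensor is zero (`eq_zero_of_traceFree`).
`weyl_eq_zero_of_electric` carries this back to coordinates.

Sense (a) reduces to the torse-forming equation (`IsTwistedChart.isTorseFormingOn`): the covector of
`u` is `-dt`, which is closed, so `2 ∇u` is the Lie derivative of `g` along `∂_t`, namely `2 (∂_t f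
/ f) h`. The vanishing statements concern every chart, so this is pulled back along the transition
map from the twisted chart, and the tensor law for curvature under a change of chart is never
needed. -/

theorem pd_congr (i : Fin 4) (h : F =ᶠ[𝓝 y] G) : pd i F y = pd i G y := by
  simp only [pd, h.fderiv_eq]

theorem pd_congr_of_isOpen {s : Set R4} (hs : IsOpen s) (hy : y ∈ s) (i : Fin 4)
    (h : ∀ z ∈ s, F z = G z) : pd i F y = pd i G y :=
  pd_congr i (eventually_of_mem (hs.mem_nhds hy) h)

theorem pd_const (i : Fin 4) (c : ℝ) : pd i (fun _ => c) y = 0 := by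
  simp [pd]

theorem pd_add (i : Fin 4) (hF : ContDiffAt ℝ ∞ F y) (hG : ContDiffAt ℝ ∞ G y) :
    pd i (fun z => F z + G z) y = pd i F y + pd i G y := by
  simp only [pd]
  rw [fderiv_fun_add (hF.differentiableAt (by simp)) (hG.differentiableAt (by simp))]
  rfl

theorem pd_sub (i : Fin 4) (hF : ContDiffAt ℝ ∞ F y) (hG : ContDiffAt ℝ ∞ G y) :
    pd i (fun z => F z - G z) y = pd i F y - pd i G y := by
  simp only [pd]
  rw [fderiv_fun_sub (hF.differentiableAt (by simp)) (hG.differentiableAt (by simp))]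
  rfl

theorem pd_mul (i : Fin 4) (hF : ContDiffAt ℝ ∞ F y) (hG : ContDiffAt ℝ ∞ G y) :
    pd i (fun z => F z * G z) y = pd i F y * G y + F y * pd i G y := by
  simp only [pd]
  rw [fderiv_fun_mul (hF.differentiableAt (by simp)) (hG.differentiableAt (by simp))]
  simp only [add_apply, smul_apply, smul_eq_mul]
  ring

theorem pd_const_mul (i : Fin 4) (c : ℝ) (hF : ContDiffAt ℝ ∞ F y) :
    pd i (fun z => c * F z) y = c * pd i F y := by
  rw [pd_mul i contDiffAt_const hF, pd_const, zero_mul, zero_add]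

theorem pd_neg (i : Fin 4) : pd i (fun z => -F z) y = -pd i F y := by
  simp [pd]

theorem pd_sum {ι : Type*} (S : Finset ι) (i : Fin 4) {F : ι → R4 → ℝ}
    (hF : ∀ a ∈ S, ContDiffAt ℝ ∞ (F a) y) :
    pd i (fun z => ∑ a ∈ S, F a z) y = ∑ a ∈ S, pd i (F a) y := by
  simp only [pd]
  rw [fderiv_fun_sum fun a ha => (hF a ha).differentiableAt (by simp)]
  simp

theorem contDiffAt_pd (i : Fin 4) (hF : ContDiffAt ℝ ∞ F y) :
    ContDiffAt ℝ ∞ (pd i F) y :=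
  (hF.fderiv_right (m := ∞) le_rfl).clm_apply contDiffAt_const

theorem pd_comm (i j : Fin 4) (hF : ContDiffAt ℝ ∞ F y) :
    pd i (fun z => pd j F z) y = pd j (fun z => pd i F z) y := by
  have h2 : DifferentiableAt ℝ (fderiv ℝ F) y :=
    (hF.fderiv_right (m := ∞) le_rfl).differentiableAt (by simp)
  have key : ∀ a b : Fin 4, pd a (fun z => pd b F z) y =
      fderiv ℝ (fderiv ℝ F) y (EuclideanSpace.single a 1) (EuclideanSpace.single b 1) := by
    intro a b
    simp only [pd]
    rw [fderiv_clm_apply h2 (by fun_prop)]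
    simp
  rw [key, key]
  exact hF.isSymmSndFDerivAt (by
    rw [minSmoothness_of_isRCLikeNormedField]
    exact WithTop.coe_le_coe.2 (le_top (a := (2 : ℕ∞)))) _ _

theorem fderiv_apply_eq_sum (F : R4 → ℝ) (y v : R4) :
    fderiv ℝ F y v = ∑ a, v a * pd a F y := by
  have hv : v = ∑ a, v a • (EuclideanSpace.single a (1 : ℝ) : R4) := by
    simpa using ((EuclideanSpace.basisFun (Fin 4) ℝ).sum_repr v).symm
  conv_lhs => rw [hv]
  simp [pd]

theorem pd_comp {τ : R4 → R4} (i : Fin 4) (hF : DifferentiableAt ℝ F (τ y))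
    (hτ : DifferentiableAt ℝ τ y) :
    pd i (fun z => F (τ z)) y = ∑ a, pd i (fun z => τ z a) y * pd a F (τ y) := by
  have h : fderiv ℝ (fun z => F (τ z)) y = (fderiv ℝ F (τ y)).comp (fderiv ℝ τ y) :=
    fderiv_comp y hF hτ
  have h' : ∀ a, pd i (fun z => τ z a) y = fderiv ℝ τ y (EuclideanSpace.single i 1) a := by
    intro a
    have := ((EuclideanSpace.proj (𝕜 := ℝ) a : R4 →L[ℝ] ℝ).hasFDerivAt.comp y
      hτ.hasFDerivAt).fderiv
    exact congrArg (fun L : R4 →L[ℝ] ℝ => L (EuclideanSpace.single i 1)) this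
  rw [pd, h, ContinuousLinearMap.comp_apply, fderiv_apply_eq_sum]
  simp only [h']

end PartialDerivatives

/-! ### Orthonormal frames adapted to a unit time-like vector. -/

section Frames

/-- The Minkowski scalar products `η_{ab}` of the vectors of an orthonormal frame. -/
def minkowski (a b : Fin 4) : ℝ :=
  if a = b then (if a = 0 then -1 else 1) else 0

variable {V : Type*} [AddCommGroup V] [Module ℝ V] {B : LinearMap.BilinForm ℝ V}

/-- The reflection exchanging the first frame vector with `u` makes `u` the first vector. -/
theorem exists_frame_of_ne (hB : ∀ v w, B v w = B w v) {b : Fin 4 → V}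
    (hb : ∀ i j, B (b i) (b j) = minkowski i j) {u : V} (hu : B u u = -1)
    (h : B (b 0) u ≠ -1) :
    ∃ c : Fin 4 → V, (∀ i j, B (c i) (c j) = minkowski i j) ∧ c 0 = u := by
  have h00 : B (b 0) (b 0) = -1 := by simp [hb, minkowski]
  have h0 : B (b 0) u + 1 ≠ 0 := fun h' => h (by linarith)
  set s := b 0 - u with hs
  have hss : B s s = -2 * (B (b 0) u + 1) := by
    simp only [hs, map_sub, LinearMap.sub_apply, h00, hu, hB u (b 0)]
    ring
  have hss0 : B s s ≠ 0 := by
    rw [hss]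
    exact mul_ne_zero (by norm_num) h0
  refine ⟨fun i => b i - (2 * B (b i) s / B s s) • s, fun i j => ?_, ?_⟩
  · simp only [map_sub, LinearMap.sub_apply, map_smul, LinearMap.smul_apply, smul_eq_mul, hb,
      hB s (b _)]
    field_simp
    ring
  -- `b 0` and `u` have the same norm, so `B s s = 2 B (b 0) s` and the reflection subtracts exactly
  -- `s` from `b 0`.
  · have h1 : 2 * B (b 0) s / B s s = 1 := by
      rw [div_eq_one_iff_eq hss0, hss]
      simp only [hs, map_sub, h00]
      ring
    change b 0 - (2 * B (b 0) s / B s s) • s = u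
    rw [h1, one_smul, hs, sub_sub_cancel]

/-- The reflection along `b 0 - u` degenerates when that vector is null, that is when `B (b 0) u =
-1`. Replacing `b 0` by `-b 0` changes this product to `1` and avoids the case. -/
theorem exists_frame (hB : ∀ v w, B v w = B w v) {b : Fin 4 → V}
    (hb : ∀ i j, B (b i) (b j) = minkowski i j) {u : V} (hu : B u u = -1) :
    ∃ c : Fin 4 → V, (∀ i j, B (c i) (c j) = minkowski i j) ∧ c 0 = u := by
  by_cases h : B (b 0) u = -1
  · refine exists_frame_of_ne (b := fun i => if i = 0 then -b i else b i) hB (fun i j => ?_) hu ?_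
    · by_cases hi : i = 0 <;> by_cases hj : j = 0 <;>
        simp [hi, hj, hb, minkowski]
      · simp [Ne.symm hj]
    · norm_num [h]
  · exact exists_frame_of_ne hB hb hu h

end Frames

/-! ### Components in a chart, and the inverse metric. -/

section Charts

variable {M : Type*} [TopologicalSpace M] [ChartedSpace R4 M]
  {g : LorentzMetric M} {u : ∀ p : M, TangentSpace (𝓡 4) p}
  {e : OpenPartialHomeomorph M R4} {y : R4}

theorem mdifferentiable_of_mem_maximalAtlas (he : e ∈ IsManifold.maximalAtlas (𝓡 4) ∞ M) :
    e.MDifferentiable (𝓡 4) (𝓡 4) :=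
  ⟨(contMDiffOn_of_mem_maximalAtlas he).mdifferentiableOn (by simp),
    (contMDiffOn_symm_of_mem_maximalAtlas he).mdifferentiableOn (by simp)⟩

/-- The components in the chart `e` of a tangent vector at `p`. -/
def compAt (e : OpenPartialHomeomorph M R4) (p : M) (v : TangentSpace (𝓡 4) p) : R4 :=
  mfderiv (𝓡 4) (𝓡 4) e p v

theorem eq_sum_compAt (he : e ∈ IsManifold.maximalAtlas (𝓡 4) ∞ M) (hy : y ∈ e.target)
    (v : TangentSpace (𝓡 4) (e.symm y)) : v = ∑ i, compAt e (e.symm y) v i • coordVec e y i := by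
  have h := (mdifferentiable_of_mem_maximalAtlas he).symm_comp_deriv (e.map_target hy)
  have h1 : mfderiv (𝓡 4) (𝓡 4) e.symm y (compAt e (e.symm y) v) = v := by
    have := congrArg (fun L => L v) h
    rw [e.right_inv hy] at this
    exact this
  have hv : compAt e (e.symm y) v = ∑ a, compAt e (e.symm y) v a • (EuclideanSpace.single a (1 : ℝ) : R4) := by
    simpa using ((EuclideanSpace.basisFun (Fin 4) ℝ).sum_repr (compAt e (e.symm y) v)).symm
  conv_lhs => rw [← h1, hv]
  let L : R4 →L[ℝ] TangentSpace (𝓡 4) (e.symm y) := mfderiv (𝓡 4) (𝓡 4) e.symm y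
  change L (∑ a, compAt e (e.symm y) v a • (EuclideanSpace.single a (1 : ℝ) : R4)) = _
  simp only [map_sum, map_smul]
  rfl

theorem val_eq_sum_compAt_symm (he : e ∈ IsManifold.maximalAtlas (𝓡 4) ∞ M) (hy : y ∈ e.target)
    (v w : TangentSpace (𝓡 4) (e.symm y)) :
    g.val (e.symm y) v w = ∑ i, compAt e (e.symm y) v i * ∑ j, compAt e (e.symm y) w j * metric g e y i j := by
  conv_lhs => rw [eq_sum_compAt he hy v, eq_sum_compAt he hy w]
  simp only [map_sum, map_smul, LinearMap.sum_apply, LinearMap.smul_apply, smul_eq_mul,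
    Finset.mul_sum]
  rw [Finset.sum_comm]
  refine Finset.sum_congr rfl fun i _ => Finset.sum_congr rfl fun j _ => ?_
  rw [metric]
  ring

theorem metric_symm (i j : Fin 4) : metric g e y i j = metric g e y j i :=
  g.symm _ _ _

theorem contDiffAt_metric (he : e ∈ IsManifold.maximalAtlas (𝓡 4) ∞ M) (hy : y ∈ e.target)
    (i j : Fin 4) : ContDiffAt ℝ ∞ (fun z => metric g e z i j) y :=
  (g.smooth e he i j).contDiffAt (e.open_target.mem_nhds hy)

theorem exists_frame_components (he : e ∈ IsManifold.maximalAtlas (𝓡 4) ∞ M)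
    (hy : y ∈ e.target) (hu : g.val (e.symm y) (u (e.symm y)) (u (e.symm y)) = -1) :
    ∃ P : Fin 4 → Fin 4 → ℝ,
      (∀ a b, ∑ i, P a i * ∑ j, P b j * metric g e y i j = minkowski a b) ∧
      ∀ i, P 0 i = upper u e y i := by
  obtain ⟨b, hb⟩ := g.lorentzian (e.symm y)
  obtain ⟨c, hc, hc0⟩ := exists_frame (g.symm (e.symm y)) hb hu
  refine ⟨fun a i => compAt e (e.symm y) (c a) i, fun a b => ?_, fun i => ?_⟩
  · rw [← val_eq_sum_compAt_symm he hy, hc]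
  · simp only [hc0]
    rfl

theorem exists_orthonormal_components (he : e ∈ IsManifold.maximalAtlas (𝓡 4) ∞ M)
    (hy : y ∈ e.target) :
    ∃ P : Fin 4 → Fin 4 → ℝ,
      ∀ a b, ∑ i, P a i * ∑ j, P b j * metric g e y i j = minkowski a b := by
  obtain ⟨b, hb⟩ := g.lorentzian (e.symm y)
  refine ⟨fun a i => compAt e (e.symm y) (b a) i, fun a c => ?_⟩
  rw [← val_eq_sum_compAt_symm he hy, hb]
  rfl

theorem minkowski_mul_self :
    Matrix.of minkowski * Matrix.of minkowski = (1 : Matrix (Fin 4) (Fin 4) ℝ) := by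
  ext a b
  fin_cases a <;> fin_cases b <;> simp [Matrix.mul_apply, minkowski]

theorem frame_mul (P : Fin 4 → Fin 4 → ℝ)
    (hP : ∀ a b, ∑ i, P a i * ∑ j, P b j * metric g e y i j = minkowski a b) :
    Matrix.of P * (Matrix.of (metric g e y) * (Matrix.of P).transpose) = Matrix.of minkowski := by
  ext a b
  simp only [Matrix.of_apply, ← hP, Matrix.mul_apply, Matrix.transpose_apply, mul_comm (P b _)]

theorem isUnit_det_minkowski : IsUnit (Matrix.of minkowski).det := by
  have := congrArg Matrix.det minkowski_mul_self
  rw [Matrix.det_mul, Matrix.det_one] at this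
  exact IsUnit.of_mul_eq_one _ this

theorem isUnit_det_frame {P : Fin 4 → Fin 4 → ℝ}
    (hP : ∀ a b, ∑ i, P a i * ∑ j, P b j * metric g e y i j = minkowski a b) :
    IsUnit (Matrix.of P).det := by
  have h := isUnit_det_minkowski
  rw [← frame_mul P hP, Matrix.det_mul] at h
  exact isUnit_of_mul_isUnit_left h

theorem isUnit_det_metric (he : e ∈ IsManifold.maximalAtlas (𝓡 4) ∞ M)
    (hy : y ∈ e.target) : IsUnit (Matrix.of (metric g e y)).det := by
  obtain ⟨P, hP⟩ := exists_orthonormal_components (g := g) he hy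
  have h := isUnit_det_minkowski
  rw [← frame_mul P hP, Matrix.det_mul, Matrix.det_mul] at h
  exact isUnit_of_mul_isUnit_left (isUnit_of_mul_isUnit_right h)

theorem sum_metricInv_mul (he : e ∈ IsManifold.maximalAtlas (𝓡 4) ∞ M)
    (hy : y ∈ e.target) (k m : Fin 4) :
    ∑ l, metricInv g e y k l * metric g e y l m = if k = m then 1 else 0 := by
  have := congrFun (congrFun (Matrix.nonsing_inv_mul _ (isUnit_det_metric (g := g) he hy)) k) m
  simpa [Matrix.mul_apply, Matrix.one_apply, metricInv] using this

theorem sum_metric_mul (he : e ∈ IsManifold.maximalAtlas (𝓡 4) ∞ M)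
    (hy : y ∈ e.target) (k m : Fin 4) :
    ∑ l, metric g e y k l * metricInv g e y l m = if k = m then 1 else 0 := by
  have := congrFun (congrFun (Matrix.mul_nonsing_inv _ (isUnit_det_metric (g := g) he hy)) k) m
  simpa [Matrix.mul_apply, Matrix.one_apply, metricInv] using this

theorem contDiffAt_det {n : ℕ} {A : R4 → Matrix (Fin n) (Fin n) ℝ}
    (hA : ∀ i j, ContDiffAt ℝ ∞ (fun z => A z i j) y) :
    ContDiffAt ℝ ∞ (fun z => (A z).det) y := by
  simp only [Matrix.det_apply']
  exact ContDiffAt.sum fun σ _ => contDiffAt_const.mul (contDiffAt_prod fun i _ => hA _ _)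

/-- By Cramer's rule the entries are minors, polynomial in the metric, divided by a nonzero
determinant. -/
theorem contDiffAt_metricInv (he : e ∈ IsManifold.maximalAtlas (𝓡 4) ∞ M)
    (hy : y ∈ e.target) (k l : Fin 4) : ContDiffAt ℝ ∞ (fun z => metricInv g e z k l) y := by
  simp only [metricInv, Matrix.inv_def, Ring.inverse_eq_inv', Matrix.smul_apply, smul_eq_mul,
    Matrix.adjugate_apply]
  refine (contDiffAt_det fun i j => contDiffAt_metric he hy i j).inv
    (isUnit_det_metric he hy).ne_zero |>.mul (contDiffAt_det fun i j => ?_)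
  simp only [Matrix.updateRow_apply]
  split_ifs
  · exact contDiffAt_const
  · exact contDiffAt_metric he hy i j

/-- The inverse metric in terms of the components of an orthonormal frame. -/
theorem metricInv_eq_sum_frame (he : e ∈ IsManifold.maximalAtlas (𝓡 4) ∞ M)
    (hy : y ∈ e.target) {P : Fin 4 → Fin 4 → ℝ}
    (hP : ∀ a b, ∑ i, P a i * ∑ j, P b j * metric g e y i j = minkowski a b) (k l : Fin 4) :
    metricInv g e y k l = ∑ a, minkowski a a * (P a k * P a l) := by
  have hu := isUnit_det_metric (g := g) he hy
  -- From `P g Pᵀ = η` and `η² = 1` comes `P (g Pᵀ η) = 1`. One-sided inverses of square matrices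
  -- are two-sided, so `g⁻¹ = Pᵀ η P`.
  have h1 : Matrix.of P * (Matrix.of (metric g e y) * ((Matrix.of P).transpose *
      Matrix.of minkowski)) = 1 := by
    rw [← minkowski_mul_self, ← Matrix.mul_assoc (Matrix.of (metric g e y)),
      ← Matrix.mul_assoc, frame_mul P hP]
  have h2 := mul_eq_one_comm.1 h1
  rw [Matrix.mul_assoc] at h2
  have h3 := Matrix.inv_eq_right_inv h2
  rw [metricInv, h3]
  simp only [Matrix.mul_apply, Matrix.transpose_apply, Matrix.of_apply, Finset.sum_mul]
  rw [Finset.sum_comm]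
  fin_cases k <;> fin_cases l <;> simp [Fin.sum_univ_four, minkowski]

end Charts

/-! ### Symmetries of the Riemann tensor. -/

section Curvature

variable {M : Type*} [TopologicalSpace M] [ChartedSpace R4 M]
  {g : LorentzMetric M} {e : OpenPartialHomeomorph M R4} {y : R4}

variable (g e) in
/-- The Christoffel symbols of the first kind `Γ_{l,ij} = g_{lp} Γ^p_{ij}`. -/
def christoffelFirst (y : R4) (l i j : Fin 4) : ℝ :=
  (1 / 2) * (pd i (fun z => metric g e z l j) y + pd j (fun z => metric g e z l i) y
      - pd l (fun z => metric g e z i j) y)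

theorem pd_metric_symm (i j k : Fin 4) :
    pd k (fun z => metric g e z i j) y = pd k (fun z => metric g e z j i) y := by
  simp only [metric_symm i j]

theorem christoffelFirst_symm (l i j : Fin 4) :
    christoffelFirst g e y l i j = christoffelFirst g e y l j i := by
  simp only [christoffelFirst, pd_metric_symm i j]
  ring

theorem christoffel_symm (k i j : Fin 4) :
    christoffel g e y k i j = christoffel g e y k j i := by
  simp only [christoffel, pd_metric_symm i j]
  congr 1
  refine Finset.sum_congr rfl fun l _ => ?_
  ring

/-- Metric compatibility of the Levi-Civita connection, with all indices lowered. -/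
theorem pd_metric (j l p : Fin 4) : pd j (fun z => metric g e z l p) y =
    christoffelFirst g e y l j p + christoffelFirst g e y p j l := by
  simp only [christoffelFirst, pd_metric_symm p l, pd_metric_symm l j, pd_metric_symm p j]
  ring

theorem sum_metric_mul_christoffel (he : e ∈ IsManifold.maximalAtlas (𝓡 4) ∞ M)
    (hy : y ∈ e.target) (l i j : Fin 4) :
    ∑ p, metric g e y l p * christoffel g e y p i j = christoffelFirst g e y l i j := by
  have h := sum_metric_mul (g := g) he hy l
  simp only [christoffel, christoffelFirst, Finset.mul_sum]
  rw [Finset.sum_comm]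
  have h2 : ∀ q (X : ℝ), ∑ p, metric g e y l p * (1 / 2 * (metricInv g e y p q * X)) =
      (if l = q then 1 else 0) * (1 / 2 * X) := by
    intro q X
    rw [← h, Finset.sum_mul]
    refine Finset.sum_congr rfl fun p _ => ?_
    ring
  simp only [h2]
  simp

theorem contDiffAt_christoffel (he : e ∈ IsManifold.maximalAtlas (𝓡 4) ∞ M)
    (hy : y ∈ e.target) (k i j : Fin 4) :
    ContDiffAt ℝ ∞ (fun z => christoffel g e z k i j) y := by
  have h := fun a b c => contDiffAt_pd c (contDiffAt_metric (g := g) he hy a b)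
  exact contDiffAt_const.mul <| ContDiffAt.sum fun l _ =>
    (contDiffAt_metricInv he hy k l).mul (((h _ _ _).add (h _ _ _)).sub (h _ _ _))

/-- The Leibniz rule moves the metric inside the derivative. In `riemann_eq`, one half of the
correction term cancels the quadratic Christoffel term already present and reverses its sign. -/
theorem sum_metric_mul_pd_christoffel (he : e ∈ IsManifold.maximalAtlas (𝓡 4) ∞ M)
    (hy : y ∈ e.target) (j l k m : Fin 4) :
    ∑ p, metric g e y l p * pd j (fun z => christoffel g e z p k m) y =
      pd j (fun z => christoffelFirst g e z l k m) y -
        ∑ p, (christoffelFirst g e y l j p + christoffelFirst g e y p j l) *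
          christoffel g e y p k m := by
  rw [← pd_congr_of_isOpen e.open_target hy j
    fun z hz => sum_metric_mul_christoffel (g := g) he hz l k m,
    pd_sum _ _ fun p _ => (contDiffAt_metric he hy l p).mul (contDiffAt_christoffel he hy p k m)]
  simp only [pd_mul j (contDiffAt_metric he hy l _) (contDiffAt_christoffel he hy _ k m),
    ← pd_metric, Finset.sum_add_distrib]
  ring

theorem pd_christoffelFirst (he : e ∈ IsManifold.maximalAtlas (𝓡 4) ∞ M)
    (hy : y ∈ e.target) (j l k m : Fin 4) :
    pd j (fun z => christoffelFirst g e z l k m) y =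
      (1 / 2) * (pd j (fun z => pd k (fun z => metric g e z l m) z) y
        + pd j (fun z => pd m (fun z => metric g e z l k) z) y
        - pd j (fun z => pd l (fun z => metric g e z k m) z) y) := by
  have h := fun a b c => contDiffAt_pd c (contDiffAt_metric (g := g) he hy a b)
  simp only [christoffelFirst]
  rw [pd_const_mul j _ (((h _ _ _).add (h _ _ _)).sub (h _ _ _)),
    pd_sub j ((h _ _ _).add (h _ _ _)) (h _ _ _), pd_add j (h _ _ _) (h _ _ _)]

/-- The Riemann tensor in terms of the second derivatives of the metric. -/
theorem riemann_eq (he : e ∈ IsManifold.maximalAtlas (𝓡 4) ∞ M)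
    (hy : y ∈ e.target) (j k l m : Fin 4) :
    riemann g e y j k l m =
      (1 / 2) * (pd j (fun z => pd m (fun z => metric g e z l k) z) y
        - pd j (fun z => pd l (fun z => metric g e z k m) z) y
        - pd k (fun z => pd m (fun z => metric g e z l j) z) y
        + pd k (fun z => pd l (fun z => metric g e z j m) z) y)
      + ∑ p, christoffelFirst g e y p k l * christoffel g e y p j m
      - ∑ p, christoffelFirst g e y p j l * christoffel g e y p k m := by
  have h1 : ∀ a b : Fin 4, ∑ p, metric g e y l p *
      ∑ q, christoffel g e y p a q * christoffel g e y q b m =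
      ∑ q, christoffelFirst g e y l a q * christoffel g e y q b m := by
    intro a b
    simp only [Finset.mul_sum]
    rw [Finset.sum_comm]
    simp only [← mul_assoc, ← Finset.sum_mul, sum_metric_mul_christoffel he hy]
  simp only [riemann, curvature, mul_add, mul_sub, Finset.sum_add_distrib,
    Finset.sum_sub_distrib, h1, sum_metric_mul_pd_christoffel he hy,
    pd_christoffelFirst he hy, add_mul, pd_comm k j (contDiffAt_metric (g := g) he hy l m)]
  ring

/-- Both sides equal `g_{pq} Γ^p_{ab} Γ^q_{cd}`. This makes the quadratic terms of `riemann_eq`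
share the symmetries visible in its second-derivative terms. -/
theorem sum_christoffelFirst_mul (he : e ∈ IsManifold.maximalAtlas (𝓡 4) ∞ M)
    (hy : y ∈ e.target) (a b c d : Fin 4) :
    ∑ p, christoffelFirst g e y p a b * christoffel g e y p c d =
      ∑ p, christoffelFirst g e y p c d * christoffel g e y p a b := by
  simp only [← sum_metric_mul_christoffel (g := g) he hy, Finset.sum_mul]
  rw [Finset.sum_comm]
  refine Finset.sum_congr rfl fun p _ => Finset.sum_congr rfl fun q _ => ?_
  rw [metric_symm q p]
  ring

theorem riemann_antisymm_left (j k l m : Fin 4) :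
    riemann g e y j k l m = -riemann g e y k j l m := by
  simp only [riemann, curvature, ← Finset.sum_neg_distrib, Finset.sum_sub_distrib]
  refine Finset.sum_congr rfl fun p _ => ?_
  ring

theorem riemann_antisymm_right (he : e ∈ IsManifold.maximalAtlas (𝓡 4) ∞ M)
    (hy : y ∈ e.target) (j k l m : Fin 4) :
    riemann g e y j k l m = -riemann g e y j k m l := by
  rw [riemann_eq he hy, riemann_eq he hy, sum_christoffelFirst_mul he hy k l j m,
    sum_christoffelFirst_mul he hy j l k m]
  simp only [metric_symm k l, metric_symm k m, metric_symm j l, metric_symm j m]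
  ring

theorem riemann_pair_symm (he : e ∈ IsManifold.maximalAtlas (𝓡 4) ∞ M)
    (hy : y ∈ e.target) (j k l m : Fin 4) :
    riemann g e y j k l m = riemann g e y l m j k := by
  have h := fun a b i j => pd_comm (y := y) a b (contDiffAt_metric (g := g) he hy i j)
  rw [riemann_eq he hy, riemann_eq he hy, sum_christoffelFirst_mul he hy k l j m]
  simp only [metric_symm k m, metric_symm j l, metric_symm j m,
    h l k, h l j, h m k, h m j, christoffelFirst_symm _ m j, christoffelFirst_symm _ l j,
    christoffel_symm _ l k, christoffel_symm _ m k]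
  ring

theorem curvature_eq_sum (he : e ∈ IsManifold.maximalAtlas (𝓡 4) ∞ M)
    (hy : y ∈ e.target) (j k l m : Fin 4) :
    curvature g e y j k l m = ∑ p, metricInv g e y m p * riemann g e y j k p l := by
  simp only [riemann, Finset.mul_sum]
  rw [Finset.sum_comm]
  simp [← mul_assoc, ← Finset.sum_mul, sum_metricInv_mul he hy]

theorem ricci_eq_sum (he : e ∈ IsManifold.maximalAtlas (𝓡 4) ∞ M)
    (hy : y ∈ e.target) (k l : Fin 4) :
    ricci g e y k l = ∑ m, ∑ p, metricInv g e y m p * riemann g e y m k p l := by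
  simp only [ricci, curvature_eq_sum he hy]

end Curvature

/-! ### The Ricci identity for a torse-forming velocity. -/

section TorseForming

variable {M : Type*} [TopologicalSpace M] [ChartedSpace R4 M]
  {g : LorentzMetric M} {u : ∀ p : M, TangentSpace (𝓡 4) p}
  {e : OpenPartialHomeomorph M R4} {s : Set R4} {φ : R4 → ℝ} {y : R4}

/-- In the coordinates of the chart `e`, the field `u` is smooth, time-like, unit and
torse-forming over the open set `s`. -/
structure IsTorseFormingOn (g : LorentzMetric M) (u : ∀ p : M, TangentSpace (𝓡 4) p)
    (e : OpenPartialHomeomorph M R4) (s : Set R4) (φ : R4 → ℝ) : Prop where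
  mem_maximalAtlas : e ∈ IsManifold.maximalAtlas (𝓡 4) ∞ M
  isOpen : IsOpen s
  subset : s ⊆ e.target
  upper : ∀ y ∈ s, ∀ i, ContDiffAt ℝ ∞ (fun z => upper u e z i) y
  unit : ∀ y ∈ s, g.val (e.symm y) (u (e.symm y)) (u (e.symm y)) = -1
  nabla : ∀ y ∈ s, ∀ i j, nablaLower g u e y i j =
    φ y * (metric g e y i j + lower g u e y i * lower g u e y j)

theorem contDiffAt_lower (h : IsTorseFormingOn g u e s φ) (hy : y ∈ s) (j : Fin 4) :
    ContDiffAt ℝ ∞ (fun z => lower g u e z j) y :=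
  ContDiffAt.sum fun i _ =>
    (contDiffAt_metric h.mem_maximalAtlas (h.subset hy) i j).mul (h.upper y hy i)

theorem sum_metricInv_mul_symm (he : e ∈ IsManifold.maximalAtlas (𝓡 4) ∞ M)
    (hy : y ∈ e.target) (k m : Fin 4) :
    ∑ l, metricInv g e y k l * metric g e y m l = if k = m then 1 else 0 := by
  simp only [metric_symm m, sum_metricInv_mul he hy]

theorem sum_metricInv_mul_lower (he : e ∈ IsManifold.maximalAtlas (𝓡 4) ∞ M)
    (hy : y ∈ e.target) (i : Fin 4) :
    ∑ j, metricInv g e y i j * lower g u e y j = upper u e y i := by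
  simp only [lower, Finset.mul_sum]
  rw [Finset.sum_comm]
  simp [← mul_assoc, ← Finset.sum_mul, sum_metricInv_mul_symm he hy]

theorem sum_upper_mul_lower (he : e ∈ IsManifold.maximalAtlas (𝓡 4) ∞ M)
    (hy : y ∈ e.target) (hu : g.val (e.symm y) (u (e.symm y)) (u (e.symm y)) = -1) :
    ∑ i, upper u e y i * lower g u e y i = -1 := by
  rw [← hu, val_eq_sum_compAt_symm he hy]
  refine Finset.sum_congr rfl fun i _ => ?_
  simp only [lower, compAt, upper, metric_symm _ i, mul_comm (metric g e y i _)]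

/-- No regularity of `φ` is assumed. Since `h` has trace `4 - 1 = 3`, `φ` is one third of the
divergence of `u`, hence smooth. -/
theorem contDiffAt_scalar (h : IsTorseFormingOn g u e s φ) (hy : y ∈ s) :
    ContDiffAt ℝ ∞ φ y := by
  have key : ∀ z ∈ s, (1 / 3) * ∑ i, ∑ j, metricInv g e z i j * nablaLower g u e z i j = φ z := by
    intro z hz
    have hz' := h.subset hz
    have h1 : ∑ i, ∑ j, metricInv g e z i j * metric g e z i j = 4 := by
      simp [sum_metricInv_mul_symm h.mem_maximalAtlas hz']
    have h2 : ∑ i, ∑ j, metricInv g e z i j * (lower g u e z i * lower g u e z j) = -1 := by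
      rw [← sum_upper_mul_lower h.mem_maximalAtlas hz' (h.unit z hz)]
      simp only [← sum_metricInv_mul_lower (g := g) (u := u) h.mem_maximalAtlas hz',
        Finset.sum_mul]
      refine Finset.sum_congr rfl fun i _ => Finset.sum_congr rfl fun j _ => ?_
      ring
    have h3 : ∑ i, ∑ j, metricInv g e z i j * nablaLower g u e z i j =
        φ z * (∑ i, ∑ j, metricInv g e z i j * metric g e z i j +
          ∑ i, ∑ j, metricInv g e z i j * (lower g u e z i * lower g u e z j)) := by
      simp only [h.nabla z hz, ← Finset.sum_add_distrib, Finset.mul_sum]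
      refine Finset.sum_congr rfl fun i _ => Finset.sum_congr rfl fun j _ => ?_
      ring
    rw [h3, h1, h2]
    ring
  refine ContDiffAt.congr_of_eventuallyEq ?_
    (eventually_of_mem (h.isOpen.mem_nhds hy) fun z hz => (key z hz).symm)
  have hy' := h.subset hy
  refine contDiffAt_const.mul <| ContDiffAt.sum fun i _ => ContDiffAt.sum fun j _ =>
    (contDiffAt_metricInv h.mem_maximalAtlas hy' i j).mul <|
      (contDiffAt_pd i (contDiffAt_lower h hy j)).sub <| ContDiffAt.sum fun k _ =>
      (contDiffAt_christoffel h.mem_maximalAtlas hy' k i j).mul (contDiffAt_lower h hy k)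

theorem pd_lower (h : IsTorseFormingOn g u e s φ) (hy : y ∈ s) (k m : Fin 4) :
    pd k (fun z => lower g u e z m) y = ∑ p, christoffel g e y p k m * lower g u e y p +
      φ y * (metric g e y k m + lower g u e y k * lower g u e y m) := by
  rw [← h.nabla y hy, nablaLower]
  ring

theorem pd_pd_lower (h : IsTorseFormingOn g u e s φ) (hy : y ∈ s) (j k m : Fin 4) :
    pd j (fun z => pd k (fun z => lower g u e z m) z) y =
      ∑ p, (pd j (fun z => christoffel g e z p k m) y * lower g u e y p +
        christoffel g e y p k m * pd j (fun z => lower g u e z p) y) +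
      (pd j φ y * (metric g e y k m + lower g u e y k * lower g u e y m) +
        φ y * (pd j (fun z => metric g e z k m) y +
          (pd j (fun z => lower g u e z k) y * lower g u e y m +
            lower g u e y k * pd j (fun z => lower g u e z m) y))) := by
  have hΓ := fun p => contDiffAt_christoffel (g := g) h.mem_maximalAtlas (h.subset hy) p k m
  have hl := fun p => contDiffAt_lower h hy p
  have hg := contDiffAt_metric (g := g) h.mem_maximalAtlas (h.subset hy) k m
  have hφ := contDiffAt_scalar h hy
  rw [pd_congr_of_isOpen h.isOpen hy j fun z hz => pd_lower h hz k m,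
    pd_add j (ContDiffAt.sum fun p _ => (hΓ p).mul (hl p)) (hφ.mul (hg.add ((hl k).mul (hl m)))),
    pd_sum _ _ fun p _ => (hΓ p).mul (hl p), pd_mul j hφ (hg.add ((hl k).mul (hl m))),
    pd_add j hg ((hl k).mul (hl m)), pd_mul j (hl k) (hl m)]
  simp only [pd_mul j (hΓ _) (hl _)]

/-- The curvature of the velocity field, from the Ricci identity. -/
theorem sum_lower_mul_curvature (h : IsTorseFormingOn g u e s φ) (hy : y ∈ s) (j k m : Fin 4) :
    ∑ p, lower g u e y p * curvature g e y j k m p =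
      (φ y ^ 2 * lower g u e y j - pd j φ y) *
        (metric g e y k m + lower g u e y k * lower g u e y m) -
      (φ y ^ 2 * lower g u e y k - pd k φ y) *
        (metric g e y j m + lower g u e y j * lower g u e y m) := by
  -- Equality of the mixed partials of `u_m`, once both are expanded through the torse-forming
  -- equation, is the Ricci identity.
  have h1 := pd_comm j k (contDiffAt_lower h hy m)
  rw [pd_pd_lower h hy, pd_pd_lower h hy] at h1
  have hF := sum_metric_mul_christoffel (g := g) h.mem_maximalAtlas (h.subset hy)
  have h2 : ∀ a b, ∑ p, christoffel g e y p b m * pd a (fun z => lower g u e z p) y =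
      ∑ p, christoffel g e y p b m * ∑ q, christoffel g e y q a p * lower g u e y q +
      φ y * (christoffelFirst g e y a b m +
        lower g u e y a * ∑ p, christoffel g e y p b m * lower g u e y p) := by
    intro a b
    rw [← hF]
    simp only [pd_lower h hy, mul_add, Finset.sum_add_distrib, Finset.mul_sum]
    congr 1
    congr 1 <;> refine Finset.sum_congr rfl fun p _ => ?_ <;> ring
  have h3 : ∀ a b, ∑ p, lower g u e y p *
      ∑ q, christoffel g e y p a q * christoffel g e y q b m =
      ∑ p, christoffel g e y p b m * ∑ q, christoffel g e y q a p * lower g u e y q := by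
    intro a b
    simp only [Finset.mul_sum]
    rw [Finset.sum_comm]
    refine Finset.sum_congr rfl fun p _ => Finset.sum_congr rfl fun q _ => ?_
    ring
  simp only [Finset.sum_add_distrib, h2] at h1
  simp only [pd_lower h hy, pd_metric] at h1
  simp only [curvature, mul_add, mul_sub, Finset.sum_add_distrib, Finset.sum_sub_distrib, h3]
  simp only [mul_comm (lower g u e y _) (pd _ _ _)]
  simp only [metric_symm k j, christoffelFirst_symm _ k j, christoffel_symm _ k j] at h1
  linear_combination h1

theorem sum_upper_mul_riemann (h : IsTorseFormingOn g u e s φ) (hy : y ∈ s) (j k m : Fin 4) :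
    ∑ l, upper u e y l * riemann g e y j k l m =
      (φ y ^ 2 * lower g u e y j - pd j φ y) *
        (metric g e y k m + lower g u e y k * lower g u e y m) -
      (φ y ^ 2 * lower g u e y k - pd k φ y) *
        (metric g e y j m + lower g u e y j * lower g u e y m) := by
  rw [← sum_lower_mul_curvature h hy]
  simp only [riemann, lower, Finset.mul_sum, Finset.sum_mul]
  rw [Finset.sum_comm]
  refine Finset.sum_congr rfl fun p _ => Finset.sum_congr rfl fun q _ => ?_
  ring

end TorseForming

/-! ### Pointwise algebra of curvature tensors in an orthonormal frame. -/

section Algebra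

theorem eq_zero_of_antisymm {F : Fin 4 → Fin 4 → ℝ} (h : ∀ a b, F a b = -F b a)
    (h01 : F 0 1 = 0) (h02 : F 0 2 = 0) (h03 : F 0 3 = 0) (h12 : F 1 2 = 0) (h13 : F 1 3 = 0)
    (h23 : F 2 3 = 0) (a b : Fin 4) : F a b = 0 := by
  have hd : ∀ c, F c c = 0 := fun c => by linarith [h c c]
  fin_cases a <;> fin_cases b <;>
    first
    | exact hd _
    | assumption
    | exact (h _ _).trans (neg_eq_zero.2 (by assumption))

/-- A trace-free tensor with the symmetries of the Riemann tensor vanishes if its contraction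
with the time-like vector of an orthonormal frame does. -/
theorem eq_zero_of_traceFree {W : Fin 4 → Fin 4 → Fin 4 → Fin 4 → ℝ}
    (hl : ∀ a b c d, W a b c d = -W b a c d) (hr : ∀ a b c d, W a b c d = -W a b d c)
    (hp : ∀ a b c d, W a b c d = W c d a b)
    (ht : ∀ b d, ∑ a, minkowski a a * W a b a d = 0) (h0 : ∀ a b d, W a b 0 d = 0)
    (a b c d : Fin 4) : W a b c d = 0 := by
  have h0' : ∀ a c d, W 0 a c d = 0 := fun a c d => by rw [hp, h0]
  -- The time term drops out of the trace, leaving the Ricci contraction of a three-dimensional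
  -- tensor.
  have hs : ∀ b d, W 1 b 1 d + W 2 b 2 d + W 3 b 3 d = 0 := by
    intro b d
    have := ht b d
    simp [Fin.sum_univ_four, minkowski, h0] at this
    linarith
  have hd : ∀ a c d, W a a c d = 0 := fun a c d => by linarith [hl a a c d]
  have hd' : ∀ a b c, W a b c c = 0 := fun a b c => by linarith [hr a b c c]
  -- Each diagonal equation says that two sectional components sum to zero; the three together kill
  -- all of them. Each off-diagonal equation contains a single component.
  have h11 := hs 1 1
  have h22 := hs 2 2
  have h33 := hs 3 3
  have h12 := hs 1 2
  have h13 := hs 1 3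
  have h23 := hs 2 3
  simp only [hd, hd'] at h11 h22 h33 h12 h13 h23
  have e1 : W 2 1 2 1 = W 1 2 1 2 := by rw [hl, hr, neg_neg]
  have e2 : W 3 1 3 1 = W 1 3 1 3 := by rw [hl, hr, neg_neg]
  have e3 : W 3 2 3 2 = W 2 3 2 3 := by rw [hl, hr, neg_neg]
  have k12 : W 1 2 1 2 = 0 := by linarith
  have k13 : W 1 3 1 3 = 0 := by linarith
  have k23 : W 2 3 2 3 = 0 := by linarith
  have k1 : W 1 3 2 3 = 0 := by linarith [hl 3 1 3 2, hr 1 3 3 2]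
  have k2 : W 1 2 2 3 = 0 := by linarith [hl 2 1 2 3]
  have k3 : W 1 2 1 3 = 0 := by linarith
  refine eq_zero_of_antisymm (F := fun a b => W a b c d) (fun a b => hl a b c d)
    (h0' _ _ _) (h0' _ _ _) (h0' _ _ _) ?_ ?_ ?_ a b
  · exact eq_zero_of_antisymm (hr 1 2) (h0 _ _ _) (h0 _ _ _) (h0 _ _ _) k12 k3 k2 c d
  · exact eq_zero_of_antisymm (hr 1 3) (h0 _ _ _) (h0 _ _ _) (h0 _ _ _)
      (by rw [hp, k3]) k13 k1 c d
  · exact eq_zero_of_antisymm (hr 2 3) (h0 _ _ _) (h0 _ _ _) (h0 _ _ _)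
      (by rw [hp, k2]) (by rw [hp, k1]) k23 c d

/-- The components of the Weyl tensor in an orthonormal frame, from those of the Riemann tensor
`R` and of the Ricci tensor `Q`. -/
def frameWeyl (R : Fin 4 → Fin 4 → Fin 4 → Fin 4 → ℝ) (Q : Fin 4 → Fin 4 → ℝ)
    (a b c d : Fin 4) : ℝ :=
  R a b c d
    + (1 / 2) * (minkowski a d * Q b c - minkowski b d * Q a c
      + minkowski b c * Q a d - minkowski a c * Q b d)
    - (1 / 6) * (∑ m, minkowski m m * Q m m) *
      (minkowski a d * minkowski b c - minkowski b d * minkowski a c)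

theorem minkowski_symm (a b : Fin 4) : minkowski a b = minkowski b a := by
  fin_cases a <;> fin_cases b <;> simp [minkowski]

variable {R : Fin 4 → Fin 4 → Fin 4 → Fin 4 → ℝ} {Q : Fin 4 → Fin 4 → ℝ} {w : Fin 4 → ℝ}

/-- The Riemann term contributes `Q b d`; the coefficients `1/2` and `1/6` are those for which the
Ricci and scalar terms cancel it in dimension four. -/
theorem frameWeyl_traceFree (hQ : ∀ b d, Q b d = ∑ a, minkowski a a * R a b a d)
    (b d : Fin 4) : ∑ a, minkowski a a * frameWeyl R Q a b a d = 0 := by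
  have h : ∑ a, minkowski a a * frameWeyl R Q a b a d = Q b d +
      ∑ a, minkowski a a * (frameWeyl R Q a b a d - R a b a d) := by
    rw [hQ, ← Finset.sum_add_distrib]
    refine Finset.sum_congr rfl fun a _ => ?_
    ring
  rw [h]
  simp only [frameWeyl, Fin.sum_univ_four]
  fin_cases b <;> fin_cases d <;> simp [minkowski] <;> ring

/-- If the Riemann tensor contracted with the first frame vector has the form it takes for a
torse-forming velocity, the Weyl tensor is determined by its electric part. -/
theorem frameWeyl_eq_zero (hl : ∀ a b c d, R a b c d = -R b a c d)
    (hr : ∀ a b c d, R a b c d = -R a b d c) (hp : ∀ a b c d, R a b c d = R c d a b)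
    (hQ : ∀ b d, Q b d = ∑ a, minkowski a a * R a b a d)
    (hR : ∀ a b d, R a b 0 d = w a * (minkowski b d + minkowski b 0 * minkowski d 0) -
      w b * (minkowski a d + minkowski a 0 * minkowski d 0))
    (hE : ∀ b c, frameWeyl R Q 0 b c 0 = 0) (a b c d : Fin 4) :
    frameWeyl R Q a b c d = 0 := by
  have hQs : ∀ b d, Q b d = Q d b := fun b d => by simp only [hQ, hp _ b _ d]
  -- Only the two spatial directions other than `b` contribute to the trace, each giving `w b`.
  have hQ0 : ∀ b, b ≠ 0 → Q b 0 = 2 * w b := by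
    intro b hb
    rw [hQ]
    simp only [hr _ b _ 0, hR, Fin.sum_univ_four]
    fin_cases b
    · exact absurd rfl hb
    all_goals
      simp [minkowski]
      ring
  have hWl : ∀ a b c d, frameWeyl R Q a b c d = -frameWeyl R Q b a c d := fun a b c d => by
    simp only [frameWeyl, hl a b]
    ring
  have hWr : ∀ a b c d, frameWeyl R Q a b c d = -frameWeyl R Q a b d c := fun a b c d => by
    simp only [frameWeyl, hr _ _ c d]
    ring
  have hWp : ∀ a b c d, frameWeyl R Q a b c d = frameWeyl R Q c d a b := fun a b c d => by
    simp only [frameWeyl, hp a b, hQs b c, hQs a c, hQs a d, hQs b d, minkowski_symm a d,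
      minkowski_symm b d, minkowski_symm a c, minkowski_symm b c]
    ring
  refine eq_zero_of_traceFree hWl hWr hWp (frameWeyl_traceFree hQ) (fun a b d => ?_) a b c d
  by_cases ha : a = 0
  · rw [ha, hWr, hE, neg_zero]
  by_cases hb : b = 0
  · rw [hb, hWl, hWr, hE, neg_zero, neg_zero]
  by_cases hd : d = 0
  · have := hWr a b 0 0
    rw [hd]
    linarith
  -- The magnetic components: the Ricci terms are `w b η_{ad} - w a η_{bd}`, the negative of `R a b
  -- 0 d`, and the scalar term vanishes because `a` and `b` are spatial.
  simp only [frameWeyl, hR, hQ0 a ha, hQ0 b hb]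
  simp only [minkowski, ha, hb, hd, if_false, mul_zero, add_zero, zero_mul]
  split_ifs <;> ring

end Algebra

/-! ### Frame components of covariant tensors. -/

section Frame

/-- The components of a covariant tensor of rank four in a frame. -/
def frameComp (P : Fin 4 → Fin 4 → ℝ) (T : Fin 4 → Fin 4 → Fin 4 → Fin 4 → ℝ)
    (a b c d : Fin 4) : ℝ :=
  ∑ j, P a j * ∑ k, P b k * ∑ m, P d m * ∑ l, P c l * T j k l m

/-- The components of a covariant tensor of rank two in a frame. -/
def frameComp₂ (P : Fin 4 → Fin 4 → ℝ) (T : Fin 4 → Fin 4 → ℝ) (a b : Fin 4) : ℝ :=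
  ∑ i, P a i * ∑ j, P b j * T i j

variable {P : Fin 4 → Fin 4 → ℝ} {T : Fin 4 → Fin 4 → Fin 4 → Fin 4 → ℝ}

/-- In `frameComp` the third slot is summed innermost, so that `u^l R_{jklm}` can be rewritten in
place. This flat form serves for permuting slots. -/
theorem frameComp_eq_sum (a b c d : Fin 4) : frameComp P T a b c d =
    ∑ j, ∑ k, ∑ l, ∑ m, P a j * P b k * P c l * P d m * T j k l m := by
  simp only [frameComp, Finset.mul_sum]
  refine Finset.sum_congr rfl fun j _ => Finset.sum_congr rfl fun k _ => ?_
  rw [Finset.sum_comm]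
  refine Finset.sum_congr rfl fun l _ => Finset.sum_congr rfl fun m _ => ?_
  ring

theorem eq_zero_of_frame (hP : IsUnit (Matrix.of P).det) {f : Fin 4 → ℝ}
    (h : ∀ a, ∑ j, P a j * f j = 0) (j : Fin 4) : f j = 0 := by
  have hinj := Matrix.mulVec_injective_iff_isUnit.2 ((Matrix.isUnit_iff_isUnit_det _).2 hP)
  refine congrFun (hinj (a₁ := f) (a₂ := 0) ?_) j
  rw [Matrix.mulVec_zero]
  ext a
  exact h a

theorem eq_zero_of_frameComp (hP : IsUnit (Matrix.of P).det)
    (h : ∀ a b c d, frameComp P T a b c d = 0) (j k l m : Fin 4) : T j k l m = 0 :=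
  eq_zero_of_frame hP (fun c => eq_zero_of_frame hP (fun d => eq_zero_of_frame hP
    (fun b => eq_zero_of_frame hP (fun a => h a b c d) j) k) m) l

end Frame

/-! ### The Weyl tensor in a frame, and its determination by the electric part. -/

section Frame

variable {P : Fin 4 → Fin 4 → ℝ} {T T' : Fin 4 → Fin 4 → Fin 4 → Fin 4 → ℝ}

theorem frameComp_add (a b c d : Fin 4) :
    frameComp P (fun j k l m => T j k l m + T' j k l m) a b c d =
      frameComp P T a b c d + frameComp P T' a b c d := by
  simp only [frameComp, mul_add, Finset.sum_add_distrib]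

theorem frameComp_sub (a b c d : Fin 4) :
    frameComp P (fun j k l m => T j k l m - T' j k l m) a b c d =
      frameComp P T a b c d - frameComp P T' a b c d := by
  simp only [frameComp, mul_sub, Finset.sum_sub_distrib]

theorem frameComp_const_mul (r : ℝ) (a b c d : Fin 4) :
    frameComp P (fun j k l m => r * T j k l m) a b c d = r * frameComp P T a b c d := by
  simp only [frameComp, Finset.mul_sum]
  refine Finset.sum_congr rfl fun j _ => Finset.sum_congr rfl fun k _ =>
    Finset.sum_congr rfl fun l _ => Finset.sum_congr rfl fun m _ => ?_
  ring

theorem sum_mul_const_mul (v f : Fin 4 → ℝ) (c : ℝ) :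
    ∑ i, v i * (c * f i) = c * ∑ i, v i * f i := by
  simp only [Finset.mul_sum, mul_left_comm]

theorem sum_mul_mul_const (v f : Fin 4 → ℝ) (c : ℝ) :
    ∑ i, v i * (f i * c) = (∑ i, v i * f i) * c := by
  simp only [Finset.sum_mul, mul_assoc]

theorem frameComp_mul_outer (A B : Fin 4 → Fin 4 → ℝ) (a b c d : Fin 4) :
    frameComp P (fun j k l m => A j m * B k l) a b c d =
      frameComp₂ P A a d * frameComp₂ P B b c := by
  simp only [frameComp, frameComp₂, sum_mul_const_mul, sum_mul_mul_const]

theorem frameComp_swap_left (a b c d : Fin 4) :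
    frameComp P (fun j k l m => T k j l m) a b c d = frameComp P T b a c d := by
  simp only [frameComp_eq_sum]
  rw [Finset.sum_comm]
  refine Finset.sum_congr rfl fun j _ => Finset.sum_congr rfl fun k _ =>
    Finset.sum_congr rfl fun l _ => Finset.sum_congr rfl fun m _ => ?_
  ring

theorem frameComp_swap_right (a b c d : Fin 4) :
    frameComp P (fun j k l m => T j k m l) a b c d = frameComp P T a b d c := by
  simp only [frameComp_eq_sum]
  refine Finset.sum_congr rfl fun j _ => Finset.sum_congr rfl fun k _ => ?_
  rw [Finset.sum_comm]
  refine Finset.sum_congr rfl fun l _ => Finset.sum_congr rfl fun m _ => ?_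
  ring

theorem frameComp_swap_pairs (a b c d : Fin 4) :
    frameComp P (fun j k l m => T l m j k) a b c d = frameComp P T c d a b := by
  simp only [frameComp_eq_sum]
  have h : ∀ f : Fin 4 → Fin 4 → Fin 4 → Fin 4 → ℝ,
      ∑ j, ∑ k, ∑ l, ∑ m, f j k l m = ∑ l, ∑ m, ∑ j, ∑ k, f j k l m := by
    intro f
    calc _ = ∑ j, ∑ l, ∑ m, ∑ k, f j k l m := Finset.sum_congr rfl fun j _ => by
            rw [Finset.sum_comm]
            exact Finset.sum_congr rfl fun l _ => Finset.sum_comm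
      _ = _ := by
            rw [Finset.sum_comm]
            exact Finset.sum_congr rfl fun l _ => Finset.sum_comm
  rw [h]
  refine Finset.sum_congr rfl fun j _ => Finset.sum_congr rfl fun k _ =>
    Finset.sum_congr rfl fun l _ => Finset.sum_congr rfl fun m _ => ?_
  ring

theorem frameComp_mul_inner (A B : Fin 4 → Fin 4 → ℝ) (a b c d : Fin 4) :
    frameComp P (fun j k l m => A k m * B j l) a b c d =
      frameComp₂ P A b d * frameComp₂ P B a c := by
  rw [frameComp_swap_left (T := fun j k l m => A j m * B k l), frameComp_mul_outer]

variable {M : Type*} [TopologicalSpace M] [ChartedSpace R4 M]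
  {g : LorentzMetric M} {u : ∀ p : M, TangentSpace (𝓡 4) p}
  {e : OpenPartialHomeomorph M R4} {s : Set R4} {φ : R4 → ℝ} {y : R4}

theorem scalarCurvature_eq_frame (he : e ∈ IsManifold.maximalAtlas (𝓡 4) ∞ M)
    (hy : y ∈ e.target) (hP : ∀ a b, frameComp₂ P (metric g e y) a b = minkowski a b) :
    scalarCurvature g e y = ∑ a, minkowski a a * frameComp₂ P (ricci g e y) a a := by
  simp only [scalarCurvature, metricInv_eq_sum_frame he hy hP, frameComp₂, Finset.sum_mul,
    Finset.mul_sum]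
  have h : ∀ f : Fin 4 → Fin 4 → Fin 4 → ℝ,
      ∑ a, ∑ k, ∑ l, f a k l = ∑ k, ∑ l, ∑ a, f a k l := by
    intro f
    rw [Finset.sum_comm]
    exact Finset.sum_congr rfl fun k _ => Finset.sum_comm
  symm
  rw [h]
  refine Finset.sum_congr rfl fun k _ => Finset.sum_congr rfl fun l _ =>
    Finset.sum_congr rfl fun a _ => ?_
  ring

theorem ricci_frame (he : e ∈ IsManifold.maximalAtlas (𝓡 4) ∞ M)
    (hy : y ∈ e.target) (hP : ∀ a b, frameComp₂ P (metric g e y) a b = minkowski a b)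
    (b d : Fin 4) : frameComp₂ P (ricci g e y) b d =
      ∑ a, minkowski a a * frameComp P (riemann g e y) a b a d := by
  simp only [frameComp₂, ricci_eq_sum he hy, metricInv_eq_sum_frame he hy hP, frameComp_eq_sum,
    Finset.sum_mul, Finset.mul_sum]
  have h : ∀ f : Fin 4 → Fin 4 → Fin 4 → Fin 4 → Fin 4 → ℝ,
      ∑ a, ∑ m, ∑ k, ∑ p, ∑ l, f a m k p l = ∑ k, ∑ l, ∑ m, ∑ p, ∑ a, f a m k p l := by
    intro f
    calc _ = ∑ a, ∑ k, ∑ l, ∑ m, ∑ p, f a m k p l := Finset.sum_congr rfl fun a _ => by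
            rw [Finset.sum_comm]
            refine Finset.sum_congr rfl fun k _ => ?_
            rw [Finset.sum_comm (s := Finset.univ (α := Fin 4)) (f := fun l m => ∑ p, f a m k p l)]
            exact Finset.sum_congr rfl fun m _ => Finset.sum_comm
      _ = _ := by
            rw [Finset.sum_comm]
            refine Finset.sum_congr rfl fun k _ => ?_
            rw [Finset.sum_comm]
            refine Finset.sum_congr rfl fun l _ => ?_
            rw [Finset.sum_comm]
            exact Finset.sum_congr rfl fun m _ => Finset.sum_comm
  symm
  rw [h]
  refine Finset.sum_congr rfl fun k _ => Finset.sum_congr rfl fun l _ =>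
    Finset.sum_congr rfl fun m _ => Finset.sum_congr rfl fun p _ =>
    Finset.sum_congr rfl fun a _ => ?_
  ring

theorem weyl_frame (he : e ∈ IsManifold.maximalAtlas (𝓡 4) ∞ M)
    (hy : y ∈ e.target) (hP : ∀ a b, frameComp₂ P (metric g e y) a b = minkowski a b)
    (a b c d : Fin 4) : frameComp P (weyl g e y) a b c d =
      frameWeyl (frameComp P (riemann g e y)) (frameComp₂ P (ricci g e y)) a b c d := by
  -- Factors are reordered so that each product pairs the slots `(j, m), (k, l)` or `(k, m), (j,
  -- l)`, as the product lemmas require.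
  have h : weyl g e y = fun j k l m => riemann g e y j k l m
      + (1 / 2) * (metric g e y j m * ricci g e y k l - metric g e y k m * ricci g e y j l
        + ricci g e y j m * metric g e y k l - ricci g e y k m * metric g e y j l)
      - ((1 / 6) * scalarCurvature g e y) *
        (metric g e y j m * metric g e y k l - metric g e y k m * metric g e y j l) := by
    funext j k l m
    rw [weyl]
    ring
  rw [h]
  simp only [frameComp_add, frameComp_sub, frameComp_const_mul, frameComp_mul_outer,
    frameComp_mul_inner, hP, frameWeyl, scalarCurvature_eq_frame he hy hP]
  ring

/-- For a torse-forming velocity, the Weyl tensor vanishes wherever its electric part does. -/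
theorem weyl_eq_zero_of_electric (h : IsTorseFormingOn g u e s φ) (hy : y ∈ s)
    (hE : ∀ k l, electric g u e y k l = 0) (j k l m : Fin 4) : weyl g e y j k l m = 0 := by
  have he := h.mem_maximalAtlas
  have hy' := h.subset hy
  obtain ⟨P, hP, hP0⟩ := exists_frame_components (g := g) (u := u) he hy' (h.unit y hy)
  have hPm : ∀ a b, frameComp₂ P (metric g e y) a b = minkowski a b := hP
  have hlow : ∀ b, ∑ i, P b i * lower g u e y i = minkowski b 0 := by
    intro b
    rw [← hP]
    refine Finset.sum_congr rfl fun i _ => ?_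
    congr 1
    simp only [lower, hP0, metric_symm i, mul_comm]
  -- `H` and `w` are kept opaque so that simplification factors the nested sums without expanding
  -- them.
  obtain ⟨H, hH⟩ : ∃ H : Fin 4 → Fin 4 → ℝ, ∀ k m,
      metric g e y k m + lower g u e y k * lower g u e y m = H k m := ⟨_, fun _ _ => rfl⟩
  have hH' : ∀ b d, ∑ k, P b k * ∑ m, P d m * H k m =
      minkowski b d + minkowski b 0 * minkowski d 0 := by
    intro b d
    simp only [← hH, mul_add, Finset.sum_add_distrib, sum_mul_const_mul, sum_mul_mul_const, hP,
      hlow]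
  obtain ⟨w, hw⟩ : ∃ w : Fin 4 → ℝ, ∀ j k m, ∑ l, upper u e y l * riemann g e y j k l m =
      w j * H k m - w k * H j m :=
    ⟨fun j => φ y ^ 2 * lower g u e y j - pd j φ y, fun j k m => by
      rw [sum_upper_mul_riemann h hy, hH, hH]⟩
  refine eq_zero_of_frameComp (isUnit_det_frame hP) (fun a b c d => ?_) j k l m
  rw [weyl_frame he hy' hPm]
  refine frameWeyl_eq_zero (w := fun a => ∑ j, P a j * w j)
    (fun a b c d => ?_) (fun a b c d => ?_) (fun a b c d => ?_) (ricci_frame he hy' hPm)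
    (fun a b d => ?_) (fun b c => ?_) a b c d
  · rw [← frameComp_swap_left (P := P) (T := riemann g e y), ← neg_one_mul,
      ← frameComp_const_mul]
    simp only [neg_one_mul, ← riemann_antisymm_left]
  · rw [← frameComp_swap_right (P := P) (T := riemann g e y), ← neg_one_mul,
      ← frameComp_const_mul]
    simp only [neg_one_mul, ← riemann_antisymm_right he hy']
  · rw [← frameComp_swap_pairs (P := P) (T := riemann g e y)]
    simp only [← riemann_pair_symm he hy']
  · simp only [frameComp, hP0, hw, mul_sub, Finset.sum_sub_distrib, sum_mul_const_mul,
      sum_mul_mul_const, hH']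
  · rw [← weyl_frame he hy' hPm]
    -- The first frame vector is `u`, so the Weyl components with first and last index `0` are the
    -- frame components of the electric part.
    have h3 : ∑ k, P b k * ∑ l, P c l * electric g u e y k l = 0 := by
      simp only [hE, mul_zero, Finset.sum_const_zero]
    rw [← h3, frameComp_eq_sum]
    simp only [electric, Finset.mul_sum, hP0]
    rw [Finset.sum_comm]
    refine Finset.sum_congr rfl fun k _ => ?_
    rw [Finset.sum_comm]
    refine Finset.sum_congr rfl fun l _ => Finset.sum_congr rfl fun j _ =>
      Finset.sum_congr rfl fun m _ => ?_
    ring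

end Frame

/-! ### The Lie derivative of the metric along the velocity. -/

section LieDerivative

variable {M : Type*} [TopologicalSpace M] [ChartedSpace R4 M]
  {g : LorentzMetric M} {u : ∀ p : M, TangentSpace (𝓡 4) p}
  {e e' : OpenPartialHomeomorph M R4} {y : R4}

/-- For a closed velocity field, `2 ∇_i u_j` is the Lie derivative of the metric along `u`. -/
theorem two_mul_nablaLower (he : e ∈ IsManifold.maximalAtlas (𝓡 4) ∞ M) (hy : y ∈ e.target)
    (hu : ∀ i, ContDiffAt ℝ ∞ (fun z => upper u e z i) y) {i j : Fin 4}
    (hc : pd i (fun z => lower g u e z j) y = pd j (fun z => lower g u e z i) y) :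
    2 * nablaLower g u e y i j =
      ∑ l, upper u e y l * pd l (fun z => metric g e z i j) y +
      ∑ l, pd i (fun z => upper u e z l) y * metric g e y l j +
      ∑ l, pd j (fun z => upper u e z l) y * metric g e y l i := by
  have hg := fun a b => contDiffAt_metric (g := g) he hy a b
  have h1 : ∑ k, christoffel g e y k i j * lower g u e y k =
      ∑ l, upper u e y l * christoffelFirst g e y l i j := by
    simp only [← sum_metric_mul_christoffel (g := g) he hy, lower, Finset.mul_sum]
    rw [Finset.sum_comm]
    refine Finset.sum_congr rfl fun p _ => Finset.sum_congr rfl fun q _ => ?_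
    ring
  have h2 : ∀ a b, pd a (fun z => lower g u e z b) y =
      ∑ l, upper u e y l * pd a (fun z => metric g e z l b) y +
      ∑ l, pd a (fun z => upper u e z l) y * metric g e y l b := by
    intro a b
    simp only [lower]
    rw [pd_sum _ _ fun l _ => (hg l b).mul (hu l), ← Finset.sum_add_distrib]
    refine Finset.sum_congr rfl fun l _ => ?_
    rw [pd_mul a (hg l b) (hu l)]
    ring
  have h3 : 2 * ∑ l, upper u e y l * christoffelFirst g e y l i j =
      ∑ l, upper u e y l * pd i (fun z => metric g e z l j) y +
      ∑ l, upper u e y l * pd j (fun z => metric g e z l i) y -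
      ∑ l, upper u e y l * pd l (fun z => metric g e z i j) y := by
    rw [← Finset.sum_add_distrib, ← Finset.sum_sub_distrib, Finset.mul_sum]
    refine Finset.sum_congr rfl fun l _ => ?_
    rw [christoffelFirst]
    ring
  rw [nablaLower, h1, mul_sub, h3]
  -- Closedness splits `2 ∂_i u_j` into `∂_i u_j + ∂_j u_i`, and the derivatives of the metric then
  -- combine into the Lie derivative.
  have h4 := h2 i j
  have h5 := h2 j i
  linear_combination h4 + h5 + hc

/-- The Lie derivative of a metric pulled back along a map taking the vector field `U` to a
constant one. -/
theorem lieDerivative_pullback {s : Set R4} (hs : IsOpen s) (hy : y ∈ s)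
    {G K : R4 → Fin 4 → Fin 4 → ℝ} {τ U : R4 → Fin 4 → ℝ} {c : Fin 4 → ℝ}
    {L : Fin 4 → Fin 4 → ℝ} {i j : Fin 4} (hG : ∀ i j, G y i j = G y j i)
    (hτ : ∀ a, ContDiffAt ℝ ∞ (fun z => τ z a) y) (hU : ∀ l, ContDiffAt ℝ ∞ (fun z => U z l) y)
    (hK : ∀ a b, ContDiffAt ℝ ∞ (fun z => K z a b) y)
    (hGK : ∀ z ∈ s, ∀ i j, G z i j =
      ∑ a, pd i (fun z => τ z a) z * ∑ b, pd j (fun z => τ z b) z * K z a b)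
    (hc : ∀ z ∈ s, ∀ a, ∑ l, U z l * pd l (fun z => τ z a) z = c a)
    (hL : ∀ a b, ∑ l, U y l * pd l (fun z => K z a b) y = L a b) :
    ∑ l, U y l * pd l (fun z => G z i j) y + ∑ l, pd i (fun z => U z l) y * G y l j +
      ∑ l, pd j (fun z => U z l) y * G y l i =
    ∑ a, pd i (fun z => τ z a) y * ∑ b, pd j (fun z => τ z b) y * L a b := by
  have hJ := fun i a => contDiffAt_pd i (hτ a)
  obtain ⟨N, hN⟩ : ∃ N : Fin 4 → Fin 4 → ℝ, ∀ i a,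
      ∑ l, pd i (fun z => U z l) y * pd l (fun z => τ z a) y = N i a := ⟨_, fun _ _ => rfl⟩
  -- Differentiating the constant `U^l ∂_l τ^a` trades second derivatives of `τ` for first
  -- derivatives of `U`; these then cancel the two remaining terms of the Lie derivative.
  have hN' : ∀ i a, ∑ l, U y l * pd l (fun z => pd i (fun z => τ z a) z) y = -N i a := by
    intro i a
    have h := pd_congr_of_isOpen hs hy i fun z hz => hc z hz a
    rw [pd_const, pd_sum _ _ fun l _ => (hU l).mul (hJ l a)] at h
    simp only [pd_mul i (hU _) (hJ _ a), Finset.sum_add_distrib, hN] at h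
    simp only [pd_comm _ i (hτ a)]
    linarith
  have hdG : ∀ l, pd l (fun z => G z i j) y = ∑ a, ∑ b,
      (pd l (fun z => pd i (fun z => τ z a) z) y * (pd j (fun z => τ z b) y * K y a b) +
        pd l (fun z => pd j (fun z => τ z b) z) y * (pd i (fun z => τ z a) y * K y a b) +
        pd l (fun z => K z a b) y * (pd i (fun z => τ z a) y * pd j (fun z => τ z b) y)) := by
    intro l
    rw [pd_congr_of_isOpen hs hy l fun z hz => hGK z hz i j, pd_sum _ _ fun a _ =>
      (hJ i a).mul (ContDiffAt.sum fun b _ => (hJ j b).mul (hK a b))]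
    refine Finset.sum_congr rfl fun a _ => ?_
    rw [pd_mul l (hJ i a) (ContDiffAt.sum fun b _ => (hJ j b).mul (hK a b)),
      pd_sum _ _ fun b _ => (hJ j b).mul (hK a b), Finset.mul_sum, Finset.mul_sum,
      ← Finset.sum_add_distrib]
    refine Finset.sum_congr rfl fun b _ => ?_
    rw [pd_mul l (hJ j b) (hK a b)]
    ring
  have hsum : ∀ (v : Fin 4 → ℝ) (F : Fin 4 → Fin 4 → Fin 4 → ℝ),
      ∑ l, v l * ∑ a, ∑ b, F l a b = ∑ a, ∑ b, ∑ l, v l * F l a b := by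
    intro v F
    simp only [Finset.mul_sum]
    rw [Finset.sum_comm]
    exact Finset.sum_congr rfl fun a _ => Finset.sum_comm
  have hGK' : ∀ i j, G y i j = ∑ a, ∑ b,
      pd i (fun z => τ z a) y * (pd j (fun z => τ z b) y * K y a b) := by
    intro i j
    simp only [hGK y hy, Finset.mul_sum]
  have h1 : ∑ l, U y l * pd l (fun z => G z i j) y = ∑ a, ∑ b,
      (-N i a * (pd j (fun z => τ z b) y * K y a b) +
        -N j b * (pd i (fun z => τ z a) y * K y a b) +
        L a b * (pd i (fun z => τ z a) y * pd j (fun z => τ z b) y)) := by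
    simp only [hdG, hsum, mul_add, Finset.sum_add_distrib, sum_mul_mul_const, hN', hL]
  have h2 : ∑ l, pd i (fun z => U z l) y * G y l j =
      ∑ a, ∑ b, N i a * (pd j (fun z => τ z b) y * K y a b) := by
    simp only [hGK', hsum, sum_mul_mul_const, hN]
  have h3 : ∑ l, pd j (fun z => U z l) y * G y l i =
      ∑ a, ∑ b, N j b * (pd i (fun z => τ z a) y * K y a b) := by
    simp only [hG _ i, hGK', hsum, mul_left_comm (pd i _ y), sum_mul_mul_const, hN]
  rw [h1, h2, h3, ← Finset.sum_add_distrib, ← Finset.sum_add_distrib]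
  refine Finset.sum_congr rfl fun a _ => ?_
  rw [← Finset.sum_add_distrib, ← Finset.sum_add_distrib, Finset.mul_sum]
  refine Finset.sum_congr rfl fun b _ => ?_
  ring

end LieDerivative

/-! ### Change of chart. -/

section ChartChange

variable {M : Type*} [TopologicalSpace M] [ChartedSpace R4 M]
  {g : LorentzMetric M} {u : ∀ p : M, TangentSpace (𝓡 4) p}
  {e e' : OpenPartialHomeomorph M R4} {y : R4} {p : M}

theorem contDiffAt_transition (he : e ∈ IsManifold.maximalAtlas (𝓡 4) ∞ M)
    (he' : e' ∈ IsManifold.maximalAtlas (𝓡 4) ∞ M) (hy : y ∈ e.target)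
    (hy' : e.symm y ∈ e'.source) : ContDiffAt ℝ ∞ (fun z => e' (e.symm z)) y :=
  contMDiffAt_iff_contDiffAt.1 <| ContMDiffAt.comp y (contMDiffAt_of_mem_maximalAtlas he' hy')
    (contMDiffAt_symm_of_mem_maximalAtlas he hy)

theorem contDiffAt_transition_apply (he : e ∈ IsManifold.maximalAtlas (𝓡 4) ∞ M)
    (he' : e' ∈ IsManifold.maximalAtlas (𝓡 4) ∞ M) (hy : y ∈ e.target)
    (hy' : e.symm y ∈ e'.source) (a : Fin 4) :
    ContDiffAt ℝ ∞ (fun z => e' (e.symm z) a) y :=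
  (EuclideanSpace.proj (𝕜 := ℝ) a : R4 →L[ℝ] ℝ).contDiff.contDiffAt.comp y
    (contDiffAt_transition he he' hy hy')

/-- By the chain rule, components of coordinate vectors in another chart form the Jacobian of the
transition map. -/
theorem compAt_coordVec (he : e ∈ IsManifold.maximalAtlas (𝓡 4) ∞ M)
    (he' : e' ∈ IsManifold.maximalAtlas (𝓡 4) ∞ M) (hy : y ∈ e.target)
    (hy' : e.symm y ∈ e'.source) (i a : Fin 4) :
    compAt e' (e.symm y) (coordVec e y i) a = pd i (fun z => e' (e.symm z) a) y := by
  have h1 := (mdifferentiable_of_mem_maximalAtlas he').mdifferentiableAt hy'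
  have h2 := (mdifferentiable_of_mem_maximalAtlas he).mdifferentiableAt_symm hy
  have h3 : mfderiv (𝓡 4) (𝓡 4) (fun z => e' (e.symm z)) y =
      (mfderiv (𝓡 4) (𝓡 4) e' (e.symm y)).comp (mfderiv (𝓡 4) (𝓡 4) e.symm y) :=
    mfderiv_comp y h1 h2
  rw [mfderiv_eq_fderiv] at h3
  have hτ := (contDiffAt_transition he he' hy hy').differentiableAt (by simp)
  have h4 := ((EuclideanSpace.proj (𝕜 := ℝ) a : R4 →L[ℝ] ℝ).hasFDerivAt.comp y
    hτ.hasFDerivAt).fderiv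
  have h5 : pd i (fun z => e' (e.symm z) a) y =
      fderiv ℝ (fun z => e' (e.symm z)) y (EuclideanSpace.single i 1) a :=
    congrArg (fun L : R4 →L[ℝ] ℝ => L (EuclideanSpace.single i 1)) h4
  rw [h5, h3]
  rfl

theorem val_eq_sum_compAt (he : e ∈ IsManifold.maximalAtlas (𝓡 4) ∞ M) (hp : p ∈ e.source)
    (v w : TangentSpace (𝓡 4) p) :
    g.val p v w = ∑ a, compAt e p v a * ∑ b, compAt e p w b * metric g e (e p) a b := by
  obtain ⟨z, hz, rfl⟩ : ∃ z ∈ e.target, e.symm z = p := ⟨e p, e.map_source hp, e.left_inv hp⟩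
  rw [e.right_inv hz]
  exact val_eq_sum_compAt_symm he hz v w

theorem compAt_coordVec_self (he : e ∈ IsManifold.maximalAtlas (𝓡 4) ∞ M) (hy : y ∈ e.target)
    (i : Fin 4) : compAt e (e.symm y) (coordVec e y i) = EuclideanSpace.single i 1 := by
  have h := (mdifferentiable_of_mem_maximalAtlas he).comp_symm_deriv hy
  exact congrArg (fun L => L (EuclideanSpace.single i (1 : ℝ) : R4)) h

theorem compAt_eq_sum (he : e ∈ IsManifold.maximalAtlas (𝓡 4) ∞ M) (hy : y ∈ e.target)
    (v : TangentSpace (𝓡 4) (e.symm y)) (a : Fin 4) :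
    compAt e' (e.symm y) v a =
      ∑ l, compAt e (e.symm y) v l * compAt e' (e.symm y) (coordVec e y l) a := by
  let L : TangentSpace (𝓡 4) (e.symm y) →L[ℝ] R4 := mfderiv (𝓡 4) (𝓡 4) e' (e.symm y)
  change L v a = ∑ l, compAt e (e.symm y) v l * L (coordVec e y l) a
  conv_lhs => rw [eq_sum_compAt he hy v]
  simp only [map_sum, map_smul]
  simp

theorem lower_eq_val (he : e ∈ IsManifold.maximalAtlas (𝓡 4) ∞ M) (hy : y ∈ e.target)
    (j : Fin 4) : lower g u e y j = g.val (e.symm y) (u (e.symm y)) (coordVec e y j) := by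
  conv_rhs => rw [eq_sum_compAt he hy (u (e.symm y))]
  simp only [map_sum, map_smul, LinearMap.sum_apply, LinearMap.smul_apply, smul_eq_mul]
  exact Finset.sum_congr rfl fun i _ => mul_comm _ _

end ChartChange

/-! ### From the twisted form to the torse-forming equation, and the conclusion. -/

section Twisted

variable {M : Type*} [TopologicalSpace M] [ChartedSpace R4 M]
  {g : LorentzMetric M} {u : ∀ p : M, TangentSpace (𝓡 4) p}
  {e e' : OpenPartialHomeomorph M R4} {y : R4} {p : M}

/-- The time derivative of a metric of the twisted form. -/
theorem pd_zero_metric_of_twisted {f : R4 → ℝ}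
    {gs : EuclideanSpace ℝ (Fin 3) → Matrix (Fin 3) (Fin 3) ℝ}
    (he : e ∈ IsManifold.maximalAtlas (𝓡 4) ∞ M)
    (hf : ContDiffOn ℝ ∞ f e.target) (hpos : ∀ y ∈ e.target, 0 < f y)
    (hm : ∀ y ∈ e.target, metric g e y 0 0 = -1 ∧
      (∀ μ : Fin 3, metric g e y 0 μ.succ = 0) ∧
      (∀ μ ν : Fin 3, metric g e y μ.succ ν.succ = f y ^ 2 * gs (space y) μ ν))
    (hy : y ∈ e.target) (a b : Fin 4) :
    pd 0 (fun z => metric g e z a b) y = 2 * (pd 0 f y / f y) *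
      (metric g e y a b + (if a = 0 then 1 else 0) * (if b = 0 then 1 else 0)) := by
  have hconst : ∀ (a b : Fin 4) (c : ℝ), (∀ z ∈ e.target, metric g e z a b = c) →
      pd 0 (fun z => metric g e z a b) y = 0 := by
    intro a b c h
    rw [pd_congr_of_isOpen e.open_target hy 0 h, pd_const]
  cases a using Fin.cases with
  | zero =>
    cases b using Fin.cases with
    | zero =>
      rw [hconst 0 0 (-1) fun z hz => (hm z hz).1, (hm y hy).1]
      simp
    | succ ν =>
      rw [hconst 0 _ 0 fun z hz => (hm z hz).2.1 ν, (hm y hy).2.1 ν]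
      simp
  | succ μ =>
    cases b using Fin.cases with
    | zero =>
      rw [hconst _ 0 0 fun z hz => by rw [metric_symm, (hm z hz).2.1 μ], metric_symm,
        (hm y hy).2.1 μ]
      simp
    | succ ν =>
      have hfy := hf.contDiffAt (e.open_target.mem_nhds hy)
      have hd1 := (contDiffAt_metric (g := g) he hy μ.succ ν.succ).differentiableAt (by simp)
      have hsq : ContDiffAt ℝ ∞ (fun z => gs (space y) μ ν * (f z * f z)) y :=
        contDiffAt_const.mul (hfy.mul hfy)
      have hd2 := hsq.differentiableAt (by simp)
      have hcont : ContinuousAt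
          (fun t : ℝ => y + t • (EuclideanSpace.single 0 (1 : ℝ) : R4)) 0 := by fun_prop
      have hev : ∀ᶠ t : ℝ in 𝓝 0,
          y + t • (EuclideanSpace.single 0 (1 : ℝ) : R4) ∈ e.target :=
        hcont.eventually_mem (by simpa using e.open_target.mem_nhds hy)
      -- Along the time line through `y` the space coordinates are constant, so `gs` can be frozen
      -- at `space y`; it never has to be differentiated.
      have hline : lineDeriv ℝ (fun z => metric g e z μ.succ ν.succ) y
          (EuclideanSpace.single 0 (1 : ℝ)) =
          lineDeriv ℝ (fun z => gs (space y) μ ν * (f z * f z)) y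
          (EuclideanSpace.single 0 (1 : ℝ)) := by
        refine EventuallyEq.deriv_eq (hev.mono fun t ht => ?_)
        have hs : space (y + t • (EuclideanSpace.single 0 (1 : ℝ) : R4)) = space y := by
          ext κ
          simp [space]
        change metric g e _ _ _ = _
        rw [(hm _ ht).2.2, hs]
        ring
      rw [hd1.lineDeriv_eq_fderiv, hd2.lineDeriv_eq_fderiv] at hline
      change pd 0 (fun z => metric g e z μ.succ ν.succ) y =
        pd 0 (fun z => gs (space y) μ ν * (f z * f z)) y at hline
      rw [hline, pd_const_mul 0 _ (hfy.mul hfy), pd_mul 0 hfy hfy, (hm y hy).2.2]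
      have := (hpos y hy).ne'
      simp only [Fin.succ_ne_zero, if_false]
      field_simp
      ring

/-- A twisted space-time is torse-forming in any chart around each point. -/
theorem IsTwistedChart.isTorseFormingOn (he : e ∈ IsManifold.maximalAtlas (𝓡 4) ∞ M)
    (he' : e' ∈ IsManifold.maximalAtlas (𝓡 4) ∞ M) (h : IsTwistedChart g u e') :
    ∃ φ : R4 → ℝ, IsTorseFormingOn g u e (e.target ∩ e.symm ⁻¹' e'.source) φ := by
  obtain ⟨f, gs, hf, hpos, -, -, hm⟩ := h
  have hopen : IsOpen (e.target ∩ e.symm ⁻¹' e'.source) :=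
    e.isOpen_inter_preimage_symm e'.open_source
  have hτ : ∀ y ∈ e.target ∩ e.symm ⁻¹' e'.source, ∀ a,
      ContDiffAt ℝ ∞ (fun z => e' (e.symm z) a) y :=
    fun y hy a => contDiffAt_transition_apply he he' hy.1 hy.2 a
  have hu : ∀ p ∈ e'.source, compAt e' p (u p) = EuclideanSpace.single 0 1 := by
    intro p hp
    obtain ⟨z, hz, rfl⟩ : ∃ z ∈ e'.target, e'.symm z = p :=
      ⟨e' p, e'.map_source hp, e'.left_inv hp⟩
    rw [(hm z hz).2.2.2, compAt_coordVec_self he' hz]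
  -- The components of `u = ∂_t` are the time derivatives of the transition map from `e'` to `e`,
  -- which gives their smoothness.
  have hupper : ∀ y ∈ e.target ∩ e.symm ⁻¹' e'.source, ∀ i,
      upper u e y i = pd 0 (fun z => e (e'.symm z) i) (e' (e.symm y)) := by
    intro y hy i
    have hz := e'.map_source hy.2
    have hsymm : e'.symm (e' (e.symm y)) = e.symm y := e'.left_inv hy.2
    rw [← compAt_coordVec he' he hz (by rw [hsymm]; exact e.map_target hy.1),
      ← (hm _ hz).2.2.2, hsymm]
    rfl
  have hcupper : ∀ y ∈ e.target ∩ e.symm ⁻¹' e'.source, ∀ i,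
      ContDiffAt ℝ ∞ (fun z => upper u e z i) y := by
    intro y hy i
    have hz := e'.map_source hy.2
    have hsymm : e'.symm (e' (e.symm y)) = e.symm y := e'.left_inv hy.2
    refine ContDiffAt.congr_of_eventuallyEq ?_
      (eventually_of_mem (hopen.mem_nhds hy) fun z hz => hupper z hz i)
    exact (contDiffAt_pd 0 (contDiffAt_transition_apply he' he hz
      (by rw [hsymm]; exact e.map_target hy.1) i)).comp y
      (contDiffAt_transition he he' hy.1 hy.2)
  have hJu : ∀ y ∈ e.target ∩ e.symm ⁻¹' e'.source, ∀ a,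
      ∑ l, upper u e y l * pd l (fun z => e' (e.symm z) a) y = if a = 0 then 1 else 0 := by
    intro y hy a
    have := compAt_eq_sum (e' := e') he hy.1 (u (e.symm y)) a
    rw [hu _ hy.2] at this
    simp only [compAt_coordVec he he' hy.1 hy.2] at this
    refine this.symm.trans ?_
    simp
  have metric_zero : ∀ z ∈ e'.target, ∀ b, metric g e' z 0 b = if b = 0 then -1 else 0 := by
    intro z hz b
    cases b using Fin.cases with
    | zero => simp [(hm z hz).1]
    | succ μ => simp [(hm z hz).2.1]
  -- The covector of `u` is `-dt`, hence closed.
  have hlower : ∀ y ∈ e.target ∩ e.symm ⁻¹' e'.source, ∀ j,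
      lower g u e y j = -pd j (fun z => e' (e.symm z) 0) y := by
    intro y hy j
    have hz := e'.map_source hy.2
    rw [lower_eq_val he hy.1, val_eq_sum_compAt he' hy.2, hu _ hy.2]
    simp only [compAt_coordVec he he' hy.1 hy.2]
    simp [metric_zero _ hz]
  have hmetric : ∀ y ∈ e.target ∩ e.symm ⁻¹' e'.source, ∀ i j, metric g e y i j =
      ∑ a, pd i (fun z => e' (e.symm z) a) y * ∑ b, pd j (fun z => e' (e.symm z) b) y *
        metric g e' (e' (e.symm y)) a b := by
    intro y hy i j
    simp only [← compAt_coordVec he he' hy.1 hy.2]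
    exact val_eq_sum_compAt he' hy.2 _ _
  -- The scalar is the expansion rate `∂_t f / f`, read in the twisted chart.
  refine ⟨fun y => pd 0 f (e' (e.symm y)) / f (e' (e.symm y)), he, hopen,
    Set.inter_subset_left, hcupper, fun y hy => ?_, fun y hy i j => ?_⟩
  · rw [val_eq_sum_compAt he' hy.2, hu _ hy.2]
    simp [(hm _ (e'.map_source hy.2)).1]
  · have hz := e'.map_source hy.2
    have hK : ∀ a b, ContDiffAt ℝ ∞ (fun z => metric g e' (e' (e.symm z)) a b) y :=
      fun a b => ContDiffAt.comp (g := fun z => metric g e' z a b) y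
        (contDiffAt_metric he' hz a b) (contDiffAt_transition he he' hy.1 hy.2)
    -- By the chain rule, differentiating along `u` in `e` is differentiating in time in `e'`. The
    -- added indicator product is `dt ⊗ dt = u ⊗ u`.
    have hUK : ∀ a b, ∑ l, upper u e y l *
        pd l (fun z => metric g e' (e' (e.symm z)) a b) y =
        2 * (pd 0 f (e' (e.symm y)) / f (e' (e.symm y))) * (metric g e' (e' (e.symm y)) a b +
          (if a = 0 then 1 else 0) * (if b = 0 then 1 else 0)) := by
      intro a b
      rw [← pd_zero_metric_of_twisted he' hf hpos
        (fun y hy => ⟨(hm y hy).1, (hm y hy).2.1, (hm y hy).2.2.1⟩) hz]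
      have h1 : ∀ l, pd l (fun z => metric g e' (e' (e.symm z)) a b) y =
          ∑ c, pd l (fun z => e' (e.symm z) c) y *
            pd c (fun z => metric g e' z a b) (e' (e.symm y)) := fun l =>
        pd_comp (F := fun z => metric g e' z a b) (τ := fun z => e' (e.symm z)) l
          ((contDiffAt_metric he' hz a b).differentiableAt (by simp))
          ((contDiffAt_transition he he' hy.1 hy.2).differentiableAt (by simp))
      simp only [h1, Finset.mul_sum]
      rw [Finset.sum_comm]
      simp only [← mul_assoc, ← Finset.sum_mul, hJu y hy]
      simp
    have hc : pd i (fun z => lower g u e z j) y = pd j (fun z => lower g u e z i) y := by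
      rw [pd_congr_of_isOpen hopen hy i fun z hz => hlower z hz j,
        pd_congr_of_isOpen hopen hy j fun z hz => hlower z hz i, pd_neg, pd_neg,
        pd_comm i j (hτ y hy 0)]
    have h2 := two_mul_nablaLower he hy.1 (hcupper y hy) hc
    rw [lieDerivative_pullback hopen hy (fun i j => metric_symm i j) (hτ y hy) (hcupper y hy) hK
      hmetric hJu hUK] at h2
    have h3 : ∑ a, pd i (fun z => e' (e.symm z) a) y * ∑ b, pd j (fun z => e' (e.symm z) b) y *
        (2 * (pd 0 f (e' (e.symm y)) / f (e' (e.symm y))) * (metric g e' (e' (e.symm y)) a b +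
          (if a = 0 then 1 else 0) * (if b = 0 then 1 else 0))) =
        2 * (pd 0 f (e' (e.symm y)) / f (e' (e.symm y))) *
          (metric g e y i j + lower g u e y i * lower g u e y j) := by
      rw [hmetric y hy, hlower y hy, hlower y hy]
      simp only [sum_mul_const_mul]
      congr 1
      simp only [mul_add, Finset.sum_add_distrib]
      simp
    linarith

theorem IsTorseForming.isTorseFormingOn (he : e ∈ IsManifold.maximalAtlas (𝓡 4) ∞ M)
    (h : IsTorseForming g u) : ∃ φ : R4 → ℝ, IsTorseFormingOn g u e e.target φ := by
  obtain ⟨hs, hu, φ, hφ⟩ := h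
  exact ⟨fun y => φ (e.symm y), he, e.open_target, subset_rfl,
    fun y hy i => (hs e he i).contDiffAt (e.open_target.mem_nhds hy), fun y _ => hu _,
    hφ e he⟩

theorem exists_isTorseFormingOn (h : IsTwisted g u ∨ IsTorseForming g u)
    (he : e ∈ IsManifold.maximalAtlas (𝓡 4) ∞ M) (hp : p ∈ e.source) :
    ∃ (s : Set R4) (φ : R4 → ℝ), e p ∈ s ∧ IsTorseFormingOn g u e s φ := by
  rcases h with h | h
  · obtain ⟨e', he', hp', h⟩ := h p
    obtain ⟨φ, hφ⟩ := h.isTorseFormingOn he he'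
    have hmem : e p ∈ e.symm ⁻¹' e'.source := by rwa [Set.mem_preimage, e.left_inv hp]
    exact ⟨_, φ, Set.mem_inter (e.map_source hp) hmem, hφ⟩
  · obtain ⟨φ, hφ⟩ := h.isTorseFormingOn he
    exact ⟨_, φ, e.map_source hp, hφ⟩

theorem weylVanishesAt_iff_electricVanishesAt (h : IsTwisted g u ∨ IsTorseForming g u) (p : M) :
    WeylVanishesAt g p ↔ ElectricVanishesAt g u p := by
  constructor
  · intro hW e he hp k l
    simp [electric, hW e he hp]
  · intro hE e he hp
    obtain ⟨s, φ, hs, hφ⟩ := exists_isTorseFormingOn h he hp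
    exact weyl_eq_zero_of_electric hφ hs (hE e he hp)

end Twisted

end TwistedSpacetime

end

theorem mainTheorem6 (M : Type*) [TopologicalSpace M]
    [ChartedSpace (EuclideanSpace ℝ (Fin 4)) M] [IsManifold (𝓡 4) ∞ M]
    (g : TwistedSpacetime.LorentzMetric M) (u : ∀ p : M, TangentSpace (𝓡 4) p)
    (hu : TwistedSpacetime.IsTwisted g u ∨ TwistedSpacetime.IsTorseForming g u) :
    (∀ p : M, TwistedSpacetime.WeylVanishesAt g p ↔
      TwistedSpacetime.ElectricVanishesAt g u p) ∧
    ((∀ p : M, TwistedSpacetime.WeylVanishesAt g p) ↔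
      ∀ p : M, TwistedSpacetime.ElectricVanishesAt g u p) :=
  have h := TwistedSpacetime.weylVanishesAt_iff_electricVanishesAt hu
  ⟨h, forall_congr' h⟩
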